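/- Let $d\ge 0$ and let $C_0,\dots,C_d$ be $d+1$ finite families ("color classes") of points of $\mathbb{R}^d$ (in particular, each $C_i$ may be a finite set); write $|C_i|$ for the number of members of $C_i$. Points remember their color: the members of all the $C_i$ are treated as distinct vertices, even if some of them coincide as points of $\mathbb{R}^d$. A *colorful simplex* is a set $S$ of vertices with at most one vertex of each color; $\operatorname{conv}(S)$ is the convex hull of its points and $\dim S$ the dimension of their affine span. A *hitting simplex* is a colorful simplex $S$ with $\dim S=|S|-1=d$ and $0\in\operatorname{conv}(S)$, and the *colorful simplicial depth* $\operatorname{csd}(C)$ of the configuration $C=\{C_0,\dots,C_d\}$ is the number of its hitting simplices. Call $C$ *centered* if $0$ lies in the relative interior of $\operatorname{conv}(C_i)$ for all $0\le i\le d$, and *in relative general position* if no colorful simplex of dimension $d-1$ contains the origin in its convex hull. 1. If $C$ is centered and in relative general position, then $$\operatorname{csd}(C)\ \le\ 1+\prod_{i=0}^{d}\bigl(|C_i|-1\bigr).$$ 2. The bound is tight: for all $d\ge 1$ and all integers $n_0,\dots,n_d\ge 2$ there are pairwise disjoint sets $C_0,\dots,C_d\subset\mathbb{R}^d$ with $|C_i|=n_i$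 such that $C=\{C_0,\dots,C_d\}$ is centered, in relative general position, and $\operatorname{csd}(C)=1+\prod_{i=0}^{d}(n_i-1)$. 3. In particular, if $C$ is centered and in relative general position and $|C_i|=d+1$ for all $0\le i\le d$, then $\operatorname{csd}(C)\le 1+d^{\,d+1}$. -/

import Mathlib

universe u

namespace ColorfulDepth

/-! Colorful configurations in `ℝ^d`: `d + 1` finite color classes of points.  The class of color
`i` is given by its points `C i j`, `j : ι i`, with `ι i` a finite type; a finite set is the class
whose family is the inclusion `ι i = ↥(C i)`.  Vertices remember their color, so that a point
lying in two color classes counts as two vertices. -/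

/-- The configuration is centered: the origin lies in the relative interior of the convex hull of
every color class. -/
def IsCentered {d : ℕ} {ι : Fin (d + 1) → Type u}
    (C : (i : Fin (d + 1)) → ι i → EuclideanSpace ℝ (Fin d)) : Prop :=
  ∀ i, (0 : EuclideanSpace ℝ (Fin d)) ∈ intrinsicInterior ℝ (convexHull ℝ (Set.range (C i)))

/-- A colorful simplex: a set of vertices with at most one vertex of each color. -/
def IsColorful {d : ℕ} {ι : Fin (d + 1) → Type u} (S : Finset ((i : Fin (d + 1)) × ι i)) : Prop :=
  ∀ p ∈ S, ∀ q ∈ S, p.1 = q.1 → p = q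

/-- The set of points in `ℝ^d` of the vertices in `S`. -/
def points {d : ℕ} {ι : Fin (d + 1) → Type u}
    (C : (i : Fin (d + 1)) → ι i → EuclideanSpace ℝ (Fin d))
    (S : Finset ((i : Fin (d + 1)) × ι i)) : Set (EuclideanSpace ℝ (Fin d)) :=
  (fun p => C p.1 p.2) '' (S : Set ((i : Fin (d + 1)) × ι i))

/-- The (affine) dimension of a nonempty simplex, i.e. of the affine span of its points.  (It is
`0` also for the empty simplex, whose convex hull is empty.) -/
noncomputable def dim {d : ℕ} {ι : Fin (d + 1) → Type u}
    (C : (i : Fin (d + 1)) → ι i → EuclideanSpace ℝ (Fin d))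
    (S : Finset ((i : Fin (d + 1)) × ι i)) : ℕ :=
  Module.finrank ℝ (vectorSpan ℝ (points C S))

/-- Relative general position: no colorful simplex of dimension `d - 1` contains the origin in its
convex hull.  (Written `dim + 1 = d`, so that for `d = 0` the condition is void.) -/
def InRelativeGeneralPosition {d : ℕ} {ι : Fin (d + 1) → Type u}
    (C : (i : Fin (d + 1)) → ι i → EuclideanSpace ℝ (Fin d)) : Prop :=
  ∀ S : Finset ((i : Fin (d + 1)) × ι i), IsColorful S → dim C S + 1 = d →
    (0 : EuclideanSpace ℝ (Fin d)) ∉ convexHull ℝ (points C S)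

/-- A hitting simplex: a colorful simplex `S` with `dim S = |S| - 1 = d` that contains the origin
in its convex hull. -/
def IsHitting {d : ℕ} {ι : Fin (d + 1) → Type u}
    (C : (i : Fin (d + 1)) → ι i → EuclideanSpace ℝ (Fin d))
    (S : Finset ((i : Fin (d + 1)) × ι i)) : Prop :=
  IsColorful S ∧ dim C S = d ∧ S.card = d + 1 ∧
    (0 : EuclideanSpace ℝ (Fin d)) ∈ convexHull ℝ (points C S)

/-- The colorful simplicial depth: the number of hitting simplices. -/
noncomputable def csd {d : ℕ} {ι : Fin (d + 1) → Type u}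
    (C : (i : Fin (d + 1)) → ι i → EuclideanSpace ℝ (Fin d)) : ℕ :=
  Set.ncard {S : Finset ((i : Fin (d + 1)) × ι i) | IsHitting C S}

end ColorfulDepth

/-!
The upper bound is a count of partial transversals, i.e. choices of at most one vector of each color.
For a family `x` of vectors in a space `V` of dimension `k`, let `avoidingSum x` be the number of
partial transversals that do not contain the origin in their convex hull, each counted with the sign
`(-1) ^ (number of colors skipped)`.  Over all partial transversals these signs add up to
`∏ (n i - 1)`.  If `V` has dimension `d`, there are `d + 1` colors and the family is generic, then
the transversals that do not avoid the origin are exactly those of the hitting simplices, with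
sign `1`.  So the bound says that `-1 ≤ avoidingSum x`, which is the case `k = d` of
`(-1) ^ (number of colors + k) ≤ avoidingSum x` (`le_avoidingSum`).

This inequality goes by induction on `k`, in steps of two: projecting along a generic plane does not
increase the sum (`avoidingSum_map_le`).  A partial transversal `s` that avoids the origin in `V` but
not in the quotient `W` by the plane spans a cone that meets the plane in a pointed two-dimensional
cone.  The first extreme ray of that cone, in an orientation of the plane, lies in the cone of a
unique `t ⊆ s` with `k - 1` vectors (a circuit of the image in `W`), and the functional `u` that
supports the cone of `s` there depends on `t` only.  Conversely every `s` that consists of `t` and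
vectors on the positive side of `u` arises in this way (`exists_isLifted`, `IsLifted.unique`,
`IsLifted.avoids`).  For fixed `t` the signs of these `s` add up to the product, over the colors not
in `t`, of `m i - 1`, where `m i` is the number of vectors of color `i` on the positive side of `u`.
Since the origin is in the relative interior of every color class, `m i ≥ 1`, and the difference of
the two sums is a sum of nonnegative terms.

A centered configuration in relative general position is made generic by moving it in the direction
of suitable multiples of the vertices of a simplex, chosen to keep a positive relation in each color
class; the origin is interior to the hitting simplices, so small moves do not destroy them
(`csd_le`).  The bound is attained by color classes that consist of positive multiples of one vertex
of the simplex and one negative multiple of it (`exists_csd_eq`): the hitting simplices are the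
transversals of positive multiples and the one of negative multiples.
-/

set_option linter.unusedSectionVars false

universe v

/-! ### Partial transversals of a colored family of vectors -/

namespace ColorfulDepth

open Finset Module

section Basic

variable {κ : Type*} [Fintype κ] {ι : κ → Type u} {V : Type v} [AddCommGroup V] [Module ℝ V]

/-- The vector that the partial transversal `s` picks in color `i`, and `0` if it skips `i`. -/
def pick (x : (i : κ) → ι i → V) (s : (i : κ) → Option (ι i)) (i : κ) : V :=
  (s i).elim 0 (x i)

/-- The set of colors that a partial transversal uses. -/
def colors (s : (i : κ) → Option (ι i)) : Finset κ :=
  univ.filter fun i => (s i).isSome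

/-- The partial transversal `s` avoids the origin: its vectors have no nontrivial relation with
nonnegative coefficients, i.e. the origin is not in their convex hull. -/
def Avoids (x : (i : κ) → ι i → V) (s : (i : κ) → Option (ι i)) : Prop :=
  ∀ c : κ → ℝ, (∀ i, 0 ≤ c i) → ∑ i, c i • pick x s i = 0 → ∀ i ∈ colors s, c i = 0

/-- Every partial transversal with at most `dim V` vectors is linearly independent. -/
def Generic (x : (i : κ) → ι i → V) : Prop :=
  ∀ s : (i : κ) → Option (ι i), #(colors s) ≤ finrank ℝ V →
    ∀ c : κ → ℝ, ∑ i, c i • pick x s i = 0 → ∀ i ∈ colors s, c i = 0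

/-- Each color class is nonempty and has a linear relation with positive coefficients, which says
that the origin is in the relative interior of its convex hull. -/
def Balanced [∀ i, Fintype (ι i)] (x : (i : κ) → ι i → V) : Prop :=
  ∀ i, Nonempty (ι i) ∧ ∃ w : ι i → ℝ, (∀ j, 0 < w j) ∧ ∑ j, w j • x i j = 0

/-- The sign `(-1) ^ k`, where `k` is the number of colors that `s` skips. -/
def sgn (s : (i : κ) → Option (ι i)) : ℤ := ∏ i, (s i).elim (-1) fun _ => 1

open Classical in
/-- The signed number of partial transversals that avoid the origin, a version of the reduced Euler
characteristic of the complex of avoiding colorful simplices. -/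
noncomputable def avoidingSum [∀ i, Fintype (ι i)] (x : (i : κ) → ι i → V) : ℤ :=
  ∑ s : (i : κ) → Option (ι i), if Avoids x s then sgn s else 0

theorem mem_colors {s : (i : κ) → Option (ι i)} {i : κ} : i ∈ colors s ↔ s i ≠ none := by
  simp [colors, Option.isSome_iff_ne_none]

theorem pick_of_notMem (x : (i : κ) → ι i → V) {s : (i : κ) → Option (ι i)} {i : κ}
    (h : i ∉ colors s) : pick x s i = 0 := by
  have : s i = none := by simpa [mem_colors] using h
  simp [pick, this]

theorem pick_congr (x : (i : κ) → ι i → V) {s t : (i : κ) → Option (ι i)} {i : κ}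
    (h : s i = t i) : pick x s i = pick x t i := by
  simp [pick, h]

theorem pick_map {W : Type*} [AddCommGroup W] [Module ℝ W] (π : V →ₗ[ℝ] W)
    (x : (i : κ) → ι i → V) (s : (i : κ) → Option (ι i)) (i : κ) :
    pick (fun i j => π (x i j)) s i = π (pick x s i) := by
  unfold pick
  cases s i <;> simp

theorem sum_pick_map {W : Type*} [AddCommGroup W] [Module ℝ W] (π : V →ₗ[ℝ] W)
    (x : (i : κ) → ι i → V) (s : (i : κ) → Option (ι i)) (c : κ → ℝ) :
    ∑ i, c i • pick (fun i j => π (x i j)) s i = π (∑ i, c i • pick x s i) := by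
  simp [pick_map]

theorem Balanced.map [∀ i, Fintype (ι i)] {W : Type*} [AddCommGroup W] [Module ℝ W]
    (π : V →ₗ[ℝ] W) {x : (i : κ) → ι i → V} (hx : Balanced x) :
    Balanced fun i j => π (x i j) := by
  intro i
  obtain ⟨hn, w, hw, h0⟩ := hx i
  refine ⟨hn, w, hw, ?_⟩
  have := congrArg π h0
  simpa using this

/-- A linear functional that is nonzero somewhere on a balanced class is positive somewhere. -/
theorem Balanced.exists_pos [∀ i, Fintype (ι i)] {x : (i : κ) → ι i → V} (hx : Balanced x)
    (u : V →ₗ[ℝ] ℝ) {i : κ} {j : ι i} (h : u (x i j) ≠ 0) : ∃ j, 0 < u (x i j) := by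
  obtain ⟨-, w, hw, h0⟩ := hx i
  by_contra! hneg
  have h1 : ∑ j, w j * u (x i j) = 0 := by
    have := congrArg u h0
    simpa using this
  have h2 := (sum_eq_zero_iff_of_nonpos
    (fun j _ => mul_nonpos_of_nonneg_of_nonpos (hw j).le (hneg j))).1 h1 j (mem_univ j)
  rcases mul_eq_zero.1 h2 with h3 | h3
  · exact (hw j).ne' h3
  · exact h h3

open Classical in
/-- The partial transversal that keeps of `s` only the colors in `T`. -/
noncomputable def restrict (s : (i : κ) → Option (ι i)) (T : Finset κ) :
    (i : κ) → Option (ι i) := fun i => if i ∈ T then s i else none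

theorem restrict_of_mem (s : (i : κ) → Option (ι i)) {T : Finset κ} {i : κ} (h : i ∈ T) :
    restrict s T i = s i := by simp [restrict, h]

theorem restrict_of_notMem (s : (i : κ) → Option (ι i)) {T : Finset κ} {i : κ} (h : i ∉ T) :
    restrict s T i = none := by simp [restrict, h]

theorem colors_restrict (s : (i : κ) → Option (ι i)) {T : Finset κ} (hT : T ⊆ colors s) :
    colors (restrict s T) = T := by
  ext i
  by_cases h : i ∈ T
  · simpa [mem_colors, restrict_of_mem s h, h] using mem_colors.1 (hT h)
  · simp [mem_colors, restrict_of_notMem s h, h]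

/-- A relation supported on `T` is a relation of the restricted transversal. -/
theorem sum_restrict (x : (i : κ) → ι i → V) (s : (i : κ) → Option (ι i)) {T : Finset κ}
    {c : κ → ℝ} (hc : ∀ i ∉ T, i ∈ colors s → c i = 0) :
    ∑ i, c i • pick x (restrict s T) i = ∑ i, c i • pick x s i := by
  refine sum_congr rfl fun i _ => ?_
  by_cases h : i ∈ T
  · rw [pick_congr x (restrict_of_mem s h)]
  · by_cases hs : i ∈ colors s
    · simp [hc i h hs]
    · rw [pick_of_notMem x hs, pick_of_notMem]
      simp [mem_colors, restrict_of_notMem s h]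

/-- In a generic family, a relation whose support has at most `dim V` colors is trivial. -/
theorem Generic.eq_zero {x : (i : κ) → ι i → V} (hx : Generic x) {s : (i : κ) → Option (ι i)}
    {T : Finset κ} (hT : T ⊆ colors s) (hcard : #T ≤ finrank ℝ V) {c : κ → ℝ}
    (hc : ∀ i ∉ T, i ∈ colors s → c i = 0) (h0 : ∑ i, c i • pick x s i = 0) :
    ∀ i ∈ colors s, c i = 0 := by
  intro i hi
  by_cases h : i ∈ T
  · refine hx (restrict s T) (by rwa [colors_restrict s hT]) c ?_ i (by rwa [colors_restrict s hT])
    rw [sum_restrict x s hc, h0]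
  · exact hc i h hi

/-- In a generic family, at least `dim V` vectors of different colors span. -/
theorem Generic.exists_eq_sum [FiniteDimensional ℝ V] {x : (i : κ) → ι i → V} (hx : Generic x)
    {s : (i : κ) → Option (ι i)} (hs : finrank ℝ V ≤ #(colors s)) (y : V) :
    ∃ c : κ → ℝ, (∀ i ∉ colors s, c i = 0) ∧ y = ∑ i, c i • pick x s i := by
  classical
  obtain ⟨T, hT, hcard⟩ := exists_subset_card_eq hs
  have hli : LinearIndependent ℝ fun i : T => pick x s i := by
    rw [Fintype.linearIndependent_iff]
    intro g hg i
    have := hx.eq_zero (c := fun i => if h : i ∈ T then g ⟨i, h⟩ else 0) hT hcard.le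
      (fun i h _ => by simp [h]) ?_ i (hT i.2)
    · simpa using this
    · rw [← hg, ← sum_subset (subset_univ T) (fun i _ h => by simp [h]), ← sum_coe_sort]
      simp
  have hspan := hli.span_eq_top_of_card_eq_finrank' (by simpa using hcard)
  have hy : y ∈ Submodule.span ℝ (Set.range fun i : T => pick x s i) := by rw [hspan]; trivial
  obtain ⟨g, hg⟩ := (Submodule.mem_span_range_iff_exists_fun ℝ).1 hy
  refine ⟨fun i => if h : i ∈ T then g ⟨i, h⟩ else 0, fun i h => ?_, ?_⟩
  · exact dif_neg fun h' => h (hT h')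
  · rw [← hg, ← sum_subset (subset_univ T) (fun i _ h => by simp [h]),
      ← sum_coe_sort T fun i => (if h : i ∈ T then g ⟨i, h⟩ else 0) • pick x s i]
    simp

theorem Generic.functional_eq_zero [FiniteDimensional ℝ V] {x : (i : κ) → ι i → V}
    (hx : Generic x) {s : (i : κ) → Option (ι i)} (hs : finrank ℝ V ≤ #(colors s))
    {u : V →ₗ[ℝ] ℝ} (hu : ∀ i ∈ colors s, u (pick x s i) = 0) : u = 0 := by
  ext y
  obtain ⟨c, -, rfl⟩ := hx.exists_eq_sum hs y
  rw [map_sum]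
  refine sum_eq_zero fun i _ => ?_
  by_cases h : i ∈ colors s
  · simp [hu i h]
  · simp [pick_of_notMem x h]

/-- Subtracting a multiple of `l` from `m` so that the differences on `F` are nonnegative and one of
them vanishes. -/
theorem exists_sub_mul_nonneg {F : Finset κ} (hF : F.Nonempty) (m : κ → ℝ) {l : κ → ℝ}
    (hl : ∀ i ∈ F, 0 < l i) :
    ∃ i ∈ F, ∃ t : ℝ, t = m i / l i ∧ m i - t * l i = 0 ∧ ∀ k ∈ F, 0 ≤ m k - t * l k := by
  obtain ⟨i, hi, hmin⟩ := exists_min_image F (fun i => m i / l i) hF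
  refine ⟨i, hi, m i / l i, rfl, ?_, fun k hk => ?_⟩
  · field_simp [(hl i hi).ne']
    ring
  · have := hmin k hk
    rw [le_div_iff₀ (hl k hk)] at this
    linarith

/-- Carathéodory's theorem for a generic family: a partial transversal that does not avoid the
origin contains one with exactly `dim V + 1` vectors and a positive relation. -/
theorem Generic.caratheodory [FiniteDimensional ℝ V] {x : (i : κ) → ι i → V} (hx : Generic x)
    {s : (i : κ) → Option (ι i)} (hs : ¬ Avoids x s) :
    ∃ T ⊆ colors s, #T = finrank ℝ V + 1 ∧ ∃ c : κ → ℝ, (∀ i ∈ T, 0 < c i) ∧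
      (∀ i ∉ T, c i = 0) ∧ ∑ i, c i • pick x s i = 0 := by
  classical
  -- Among all nonnegative relations, one with support of minimal size.
  let P : ℕ → Prop := fun n => ∃ T ⊆ colors s, #T = n ∧ T.Nonempty ∧ ∃ c : κ → ℝ,
    (∀ i ∈ T, 0 < c i) ∧ (∀ i ∉ T, c i = 0) ∧ ∑ i, c i • pick x s i = 0
  have hsupp : ∀ c : κ → ℝ, (∀ i, 0 ≤ c i) → ∑ i, c i • pick x s i = 0 →
      ∀ i₀ ∈ colors s, c i₀ ≠ 0 → P #((colors s).filter fun i => c i ≠ 0) := by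
    intro c hc h0 i₀ hi₀ hne
    refine ⟨_, filter_subset _ _, rfl, ⟨i₀, by simp [hi₀, hne]⟩,
      fun i => if i ∈ colors s then c i else 0, ?_, ?_, ?_⟩
    · intro i hi
      rw [mem_filter] at hi
      simpa [hi.1] using (hc i).lt_of_ne' hi.2
    · intro i hi
      by_contra h
      simp_all
    · rw [← h0]
      refine sum_congr rfl fun i _ => ?_
      by_cases h : i ∈ colors s
      · simp [h]
      · simp [pick_of_notMem x h]
  have hex : ∃ n, P n := by
    unfold Avoids at hs
    push Not at hs
    obtain ⟨c, hc, h0, i, hi, hne⟩ := hs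
    exact ⟨_, hsupp c hc h0 i hi hne⟩
  obtain ⟨T, hT, hcard, hTne, c, hpos, hzero, h0⟩ := Nat.find_spec hex
  have hmin : ∀ n, P n → #T ≤ n := fun n hn => hcard ▸ Nat.find_min' hex hn
  refine ⟨T, hT, le_antisymm ?_ ?_, c, hpos, hzero, h0⟩
  · by_contra! hlt
    obtain ⟨i₁, hi₁⟩ := hTne
    have hdep : ¬ LinearIndependent ℝ fun i : (T.erase i₁ : Finset κ) => pick x s i := by
      intro hli
      have := hli.fintype_card_le_finrank
      rw [Fintype.card_coe, card_erase_of_mem hi₁] at this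
      omega
    rw [Fintype.not_linearIndependent_iff] at hdep
    obtain ⟨g, hg, k, hk⟩ := hdep
    -- A relation supported on `T.erase i₁`, with a positive coefficient.
    obtain ⟨δ, hδ0, hδ, k, hk⟩ : ∃ δ : κ → ℝ, (∀ i ∉ T.erase i₁, δ i = 0) ∧
        ∑ i, δ i • pick x s i = 0 ∧ ∃ k, 0 < δ k := by
      have hsum : ∑ i, (if h : i ∈ T.erase i₁ then g ⟨i, h⟩ else 0) • pick x s i = 0 := by
        rw [← hg, ← sum_subset (subset_univ (T.erase i₁)) (fun i _ h => by rw [dif_neg h]; simp),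
          ← sum_coe_sort]
        refine sum_congr rfl fun i _ => ?_
        rw [dif_pos i.2]
      rcases lt_or_gt_of_ne hk with h | h
      · refine ⟨fun i => -(if h : i ∈ T.erase i₁ then g ⟨i, h⟩ else 0), fun i h => ?_, ?_, k, ?_⟩
        · simp only [dif_neg h, neg_zero]
        · simp only [neg_smul, sum_neg_distrib, hsum, neg_zero]
        · simp only [dif_pos k.2]; linarith
      · refine ⟨fun i => if h : i ∈ T.erase i₁ then g ⟨i, h⟩ else 0, fun i h => ?_, hsum, k, ?_⟩
        · exact dif_neg h
        · simpa only [dif_pos k.2] using h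
    obtain ⟨i₂, hi₂, t, ht, hzero₂, hnn⟩ := exists_sub_mul_nonneg
      (F := univ.filter fun i => 0 < δ i) ⟨k, by simpa using hk⟩ c (l := δ) (by simp)
    have hδi₂ : 0 < δ i₂ := by simpa using hi₂
    have hi₂T : i₂ ∈ T.erase i₁ := by
      by_contra h
      exact hδi₂.ne' (hδ0 _ h)
    have hcnn : ∀ i, 0 ≤ c i := fun i => by
      by_cases h : i ∈ T
      · exact (hpos i h).le
      · exact (hzero i h).ge
    have ht0 : 0 ≤ t := ht ▸ div_nonneg (hcnn _) hδi₂.le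
    have hnew := hsupp (fun i => c i - t * δ i) (fun i => ?_) ?_ i₁ (hT hi₁) ?_
    · have h1 := hmin _ hnew
      have h2 : ((colors s).filter fun i => c i - t * δ i ≠ 0) ⊆ T.erase i₂ := by
        intro i hi
        rw [mem_filter] at hi
        rw [mem_erase]
        refine ⟨fun h => hi.2 (h ▸ hzero₂), ?_⟩
        by_contra h
        apply hi.2
        rw [hzero i h, hδ0 i (fun h' => h (mem_of_mem_erase h'))]
        simp
      have h3 := card_le_card h2
      rw [card_erase_of_mem (mem_of_mem_erase hi₂T)] at h3
      have h4 : 0 < #T := card_pos.2 ⟨i₁, hi₁⟩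
      omega
    · by_cases h : 0 < δ i
      · exact hnn i (by simpa using h)
      · have := mul_nonpos_of_nonneg_of_nonpos ht0 (not_lt.1 h)
        have := hcnn i
        linarith
    · simp only [sub_smul, sum_sub_distrib, h0, mul_smul, ← smul_sum, hδ, smul_zero, sub_zero]
    · simpa [hδ0 i₁ (by simp)] using (hpos i₁ hi₁).ne'
  · by_contra! hlt
    obtain ⟨i₁, hi₁⟩ := hTne
    exact (hpos i₁ hi₁).ne'
      (hx.eq_zero hT (by omega) (fun i h _ => hzero i h) h0 i₁ (hT hi₁))

end Basic

end ColorfulDepth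

/-! ### Circuits and their supporting functionals -/

namespace ColorfulDepth

open Finset Module

section Sweep

variable {κ : Type*} [Fintype κ] {ι : κ → Type u} {V W : Type v} [AddCommGroup V] [Module ℝ V]
  [AddCommGroup W] [Module ℝ W]

/-- Coordinates on a plane that is the kernel of a linear map: `a` and `b` extend to `V` the
coordinates with respect to the basis `g`, `h` of the kernel. -/
structure PlaneCoords (π : V →ₗ[ℝ] W) (g h : V) (a b : V →ₗ[ℝ] ℝ) : Prop where
  map_g : π g = 0
  map_h : π h = 0
  a_g : a g = 1
  a_h : a h = 0
  b_g : b g = 0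
  b_h : b h = 1
  eq_add : ∀ q, π q = 0 → q = a q • g + b q • h

theorem exists_planeCoords [FiniteDimensional ℝ V] [FiniteDimensional ℝ W] {π : V →ₗ[ℝ] W}
    (hπ : Function.Surjective π) (hdim : finrank ℝ V = finrank ℝ W + 2) :
    ∃ g h a b, PlaneCoords π g h a b := by
  have hker : finrank ℝ (LinearMap.ker π) = 2 := by
    have h1 := π.finrank_range_add_finrank_ker
    rw [LinearMap.range_eq_top.2 hπ, finrank_top] at h1
    omega
  let e := finBasisOfFinrankEq ℝ (LinearMap.ker π) hker
  obtain ⟨a, ha⟩ := (e.coord 0).exists_extend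
  obtain ⟨b, hb⟩ := (e.coord 1).exists_extend
  have ha' : ∀ q : LinearMap.ker π, a q = e.coord 0 q := fun q => by rw [← ha]; rfl
  have hb' : ∀ q : LinearMap.ker π, b q = e.coord 1 q := fun q => by rw [← hb]; rfl
  refine ⟨e 0, e 1, a, b, (e 0).2, (e 1).2, ?_, ?_, ?_, ?_, fun q hq => ?_⟩
  · simp [ha']
  · simp [ha']
  · simp [hb']
  · simp [hb']
  · have h1 := e.sum_repr ⟨q, hq⟩
    rw [Fin.sum_univ_two] at h1
    have h2 := ha' ⟨q, hq⟩
    have h3 := hb' ⟨q, hq⟩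
    simp only at h2 h3
    rw [h2, h3]
    exact (congrArg Subtype.val h1).symm

/-- The area form `a ∧ b`. -/
def area (a b : V →ₗ[ℝ] ℝ) (p q : V) : ℝ := a p * b q - b p * a q

theorem area_swap (a b : V →ₗ[ℝ] ℝ) (p q : V) : area a b p q = -area a b q p := by
  unfold area; ring

/-- The relation between three vectors of a plane. -/
theorem PlaneCoords.area_relation {π : V →ₗ[ℝ] W} {g h : V} {a b : V →ₗ[ℝ] ℝ}
    (hc : PlaneCoords π g h a b) {p q r : V} (hp : π p = 0) (hq : π q = 0) (hr : π r = 0) :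
    area a b q r • p + area a b r p • q + area a b p q • r = 0 := by
  have hp := hc.eq_add p hp
  have hq := hc.eq_add q hq
  have hr := hc.eq_add r hr
  unfold area
  generalize a p = a1 at *
  generalize a q = a2 at *
  generalize a r = a3 at *
  generalize b p = b1 at *
  generalize b q = b2 at *
  generalize b r = b3 at *
  subst hp hq hr
  module

/-- The combination of the vectors of `s` with coefficients `l`. -/
def comb (x : (i : κ) → ι i → V) (s : (i : κ) → Option (ι i)) (l : κ → ℝ) : V :=
  ∑ i, l i • pick x s i

/-- `t` is a minimal colorful simplex whose image under `π` contains the origin, with relation `l`;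
then `comb x t l` lies in the plane `ker π`. -/
structure IsCircuit (π : V →ₗ[ℝ] W) (x : (i : κ) → ι i → V) (t : (i : κ) → Option (ι i))
    (l : κ → ℝ) : Prop where
  card : #(colors t) = finrank ℝ W + 1
  pos : ∀ i ∈ colors t, 0 < l i
  zero : ∀ i ∉ colors t, l i = 0
  map_comb : π (comb x t l) = 0

theorem IsCircuit.nonneg {π : V →ₗ[ℝ] W} {x : (i : κ) → ι i → V} {t : (i : κ) → Option (ι i)}
    {l : κ → ℝ} (ht : IsCircuit π x t l) (i : κ) : 0 ≤ l i := by
  by_cases hi : i ∈ colors t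
  · exact (ht.pos i hi).le
  · exact (ht.zero i hi).ge

/-- `u` is the functional that vanishes on the vectors of the circuit `t` and hence on the vector
`comb x t l` of the plane `ker π`, oriented and scaled by the area form of the plane. -/
structure IsSupport (π : V →ₗ[ℝ] W) (a b : V →ₗ[ℝ] ℝ) (x : (i : κ) → ι i → V)
    (t : (i : κ) → Option (ι i)) (l : κ → ℝ) (u : V →ₗ[ℝ] ℝ) : Prop where
  circuit : IsCircuit π x t l
  ne_zero : u ≠ 0
  vanish : ∀ i ∈ colors t, u (pick x t i) = 0
  eq_area : ∀ q, π q = 0 → u q = area a b (comb x t l) q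

/-- `s` consists of the vectors of `t` and of vectors on the positive side of `u`. -/
def IsLifted (x : (i : κ) → ι i → V) (t : (i : κ) → Option (ι i)) (u : V →ₗ[ℝ] ℝ)
    (s : (i : κ) → Option (ι i)) : Prop :=
  (∀ i ∈ colors t, s i = t i) ∧ ∀ i ∈ colors s, i ∉ colors t → 0 < u (pick x s i)

theorem colors_subset {s t : (i : κ) → Option (ι i)} (h : ∀ i ∈ colors t, s i = t i) :
    colors t ⊆ colors s := fun i hi => by
  rw [mem_colors, h i hi, ← mem_colors]; exact hi

/-- The combination does not change when the transversal is enlarged outside the support. -/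
theorem comb_eq (x : (i : κ) → ι i → V) {s t : (i : κ) → Option (ι i)} {l : κ → ℝ}
    (hst : ∀ i ∈ colors t, s i = t i) (hl : ∀ i ∉ colors t, l i = 0) :
    comb x t l = comb x s l := by
  refine sum_congr rfl fun i _ => ?_
  by_cases h : i ∈ colors t
  · rw [pick_congr x (hst i h)]
  · simp [hl i h]

theorem Generic.comb_ne_zero {x : (i : κ) → ι i → V} (hx : Generic x)
    {t : (i : κ) → Option (ι i)} (hcard : #(colors t) ≤ finrank ℝ V) (hne : (colors t).Nonempty)
    {l : κ → ℝ} (hl : ∀ i ∈ colors t, 0 < l i) : comb x t l ≠ 0 := by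
  intro h
  obtain ⟨i, hi⟩ := hne
  exact (hl i hi).ne' (hx t hcard l h i hi)

theorem span_pick_lt_top [FiniteDimensional ℝ V] (x : (i : κ) → ι i → V)
    {t : (i : κ) → Option (ι i)} (ht : #(colors t) < finrank ℝ V) :
    Submodule.span ℝ ((fun i => pick x t i) '' (colors t : Set κ)) < ⊤ := by
  classical
  rw [lt_top_iff_ne_top]
  intro htop
  have h1 := finrank_span_finset_le_card (R := ℝ) ((colors t).image fun i => pick x t i)
  rw [coe_image, Set.finrank, htop, finrank_top] at h1
  have h2 := card_image_le (s := colors t) (f := fun i => pick x t i)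
  omega

theorem exists_isSupport [FiniteDimensional ℝ V] [FiniteDimensional ℝ W] {π : V →ₗ[ℝ] W}
    (hπ : Function.Surjective π) (hdim : finrank ℝ V = finrank ℝ W + 2) {g h : V}
    {a b : V →ₗ[ℝ] ℝ} (hc : PlaneCoords π g h a b) {x : (i : κ) → ι i → V} (hx : Generic x)
    (hx' : Generic fun i j => π (x i j)) {t : (i : κ) → Option (ι i)} {l : κ → ℝ}
    (ht : IsCircuit π x t l) : ∃ u, IsSupport π a b x t l u := by
  set p := comb x t l with hp
  have hp0 : p ≠ 0 := hx.comb_ne_zero (by rw [ht.card]; omega)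
    (card_pos.1 (by rw [ht.card]; omega)) ht.pos
  have hspan := span_pick_lt_top x (t := t) (by rw [ht.card]; omega)
  obtain ⟨f, hf0, hf⟩ := Submodule.exists_le_ker_of_lt_top _ hspan
  have hft : ∀ i ∈ colors t, f (pick x t i) = 0 := fun i hi =>
    hf (Submodule.subset_span ⟨i, hi, rfl⟩)
  have hfp : f p = 0 := by
    rw [hp, comb, map_sum]
    refine sum_eq_zero fun i _ => ?_
    by_cases hi : i ∈ colors t
    · simp [hft i hi]
    · simp [ht.zero i hi]
  have hpe := hc.eq_add p ht.map_comb
  have hrel : a p * f g + b p * f h = 0 := by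
    have := hfp
    rw [hpe] at this
    simpa using this
  -- The functional does not vanish on the plane: otherwise it factors through `W`, which is
  -- spanned by the images of the vectors of `t`.
  have hgh : ¬ (f g = 0 ∧ f h = 0) := by
    rintro ⟨hg, hh⟩
    apply hf0
    have hker : LinearMap.ker π ≤ LinearMap.ker f := by
      intro q hq
      rw [LinearMap.mem_ker, hc.eq_add q hq]
      simp [hg, hh]
    obtain ⟨f', hf'⟩ : ∃ f' : W →ₗ[ℝ] ℝ, f' ∘ₗ π = f :=
      ⟨(LinearMap.ker π).liftQ f hker ∘ₗ (π.quotKerEquivOfSurjective hπ).symm.toLinearMap, by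
        ext q
        have : (π.quotKerEquivOfSurjective hπ).symm (π q) = (LinearMap.ker π).mkQ q := by
          rw [LinearEquiv.symm_apply_eq]; rfl
        simp [this]⟩
    have h0 := hx'.functional_eq_zero (s := t) (u := f') (by rw [ht.card]; omega) (fun i hi => by
      rw [pick_map, ← LinearMap.comp_apply, hf', hft i hi])
    rw [← hf', h0, LinearMap.zero_comp]
  have hab : a p ^ 2 + b p ^ 2 ≠ 0 := by
    intro h0
    have h1 : a p = 0 := by nlinarith [sq_nonneg (a p), sq_nonneg (b p)]
    have h2 : b p = 0 := by nlinarith [sq_nonneg (a p), sq_nonneg (b p)]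
    apply hp0
    rw [hpe, h1, h2]
    simp
  obtain ⟨c, hcg, hch⟩ : ∃ c : ℝ, f g = c * -b p ∧ f h = c * a p := by
    refine ⟨(a p * f h - b p * f g) / (a p ^ 2 + b p ^ 2), ?_, ?_⟩
    · field_simp
      linear_combination a p * hrel
    · field_simp
      linear_combination b p * hrel
  have hc0 : c ≠ 0 := by
    rintro rfl
    exact hgh ⟨by simpa using hcg, by simpa using hch⟩
  refine ⟨c⁻¹ • f, ht, smul_ne_zero (inv_ne_zero hc0) hf0, fun i hi => by simp [hft i hi],
    fun q hq => ?_⟩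
  have hq' : f q = a q * f g + b q * f h := by
    conv_lhs => rw [hc.eq_add q hq]
    simp
  rw [LinearMap.smul_apply, hq', hcg, hch, smul_eq_mul, area]
  field_simp
  ring

theorem IsLifted.nonneg {π : V →ₗ[ℝ] W} {a b : V →ₗ[ℝ] ℝ} {x : (i : κ) → ι i → V}
    {s t : (i : κ) → Option (ι i)} {l : κ → ℝ} {u : V →ₗ[ℝ] ℝ} (hu : IsSupport π a b x t l u)
    (hs : IsLifted x t u s) (i : κ) : 0 ≤ u (pick x s i) := by
  by_cases h : i ∈ colors t
  · rw [pick_congr x (hs.1 i h), hu.vanish i h]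
  · by_cases h' : i ∈ colors s
    · exact (hs.2 i h' h).le
    · simp [pick_of_notMem x h']

theorem IsLifted.subset {π : V →ₗ[ℝ] W} {a b : V →ₗ[ℝ] ℝ} {x : (i : κ) → ι i → V}
    {s t t' : (i : κ) → Option (ι i)} {l l' : κ → ℝ} {u u' : V →ₗ[ℝ] ℝ}
    (hu : IsSupport π a b x t l u) (hs : IsLifted x t u s)
    (hu' : IsSupport π a b x t' l' u') (hs' : IsLifted x t' u' s) : colors t' ⊆ colors t := by
  have hval : ∀ (v : V →ₗ[ℝ] ℝ) (m : κ → ℝ), v (comb x s m) = ∑ i, m i * v (pick x s i) := by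
    intro v m
    simp [comb]
  have e := hu.eq_area _ hu'.circuit.map_comb
  have e' := hu'.eq_area _ hu.circuit.map_comb
  rw [area_swap, ← e, comb_eq x hs'.1 hu'.circuit.zero, comb_eq x hs.1 hu.circuit.zero, hval,
    hval] at e'
  have h1 : ∑ i, l' i * u (pick x s i) = 0 := by
    have := sum_nonneg fun i (_ : i ∈ univ) => mul_nonneg (hu'.circuit.nonneg i) (hs.nonneg hu i)
    have := sum_nonneg fun i (_ : i ∈ univ) => mul_nonneg (hu.circuit.nonneg i) (hs'.nonneg hu' i)
    linarith
  intro i hi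
  by_contra hit
  have h2 := (sum_eq_zero_iff_of_nonneg fun i _ =>
    mul_nonneg (hu'.circuit.nonneg i) (hs.nonneg hu i)).1 h1 i (mem_univ i)
  exact (mul_pos (hu'.circuit.pos i hi) (hs.2 i (colors_subset hs'.1 hi) hit)).ne' h2

/-- Uniqueness of the supporting circuit. -/
theorem IsLifted.unique {π : V →ₗ[ℝ] W} {a b : V →ₗ[ℝ] ℝ} {x : (i : κ) → ι i → V}
    {s t t' : (i : κ) → Option (ι i)} {l l' : κ → ℝ} {u u' : V →ₗ[ℝ] ℝ}
    (hu : IsSupport π a b x t l u) (hs : IsLifted x t u s)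
    (hu' : IsSupport π a b x t' l' u') (hs' : IsLifted x t' u' s) : t = t' := by
  have h1 := hs.subset hu hu' hs'
  have h2 := hs'.subset hu' hu hs
  funext i
  by_cases h : i ∈ colors t
  · rw [← hs.1 i h, hs'.1 i (h2 h)]
  · have h' : i ∉ colors t' := fun h' => h (h1 h')
    rw [mem_colors, not_not] at h h'
    rw [h, h']

/-- A total relation that is transitive on a nonempty finite set has a least element there. -/
theorem exists_least {A : Type*} (R : A → A → Prop) (F : Finset A) (hF : F.Nonempty)
    (htot : ∀ p q, R p q ∨ R q p) (htrans : ∀ p ∈ F, ∀ q ∈ F, ∀ r ∈ F, R p q → R q r → R p r) :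
    ∃ p ∈ F, ∀ q ∈ F, R p q := by
  classical
  induction hF using Finset.Nonempty.cons_induction with
  | singleton p => exact ⟨p, by simp, by simpa using htot p p⟩
  | cons p F hp hF ih =>
    obtain ⟨q, hq, hmin⟩ := ih fun p hp q hq r hr =>
      htrans p (mem_cons_of_mem hp) q (mem_cons_of_mem hq) r (mem_cons_of_mem hr)
    rcases htot p q with h | h
    · refine ⟨p, mem_cons_self _ _, fun r hr => ?_⟩
      rcases mem_cons.1 hr with rfl | hr
      · simpa using htot r r
      · exact htrans p (mem_cons_self _ _) q (mem_cons_of_mem hq) r (mem_cons_of_mem hr) h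
          (hmin r hr)
    · refine ⟨q, mem_cons_of_mem hq, fun r hr => ?_⟩
      rcases mem_cons.1 hr with rfl | hr
      · exact h
      · exact hmin r hr

end Sweep

end ColorfulDepth

/-! ### The sweep: comparison with a projection along a plane -/

namespace ColorfulDepth

open Finset Module

section Sweep

variable {κ : Type*} [Fintype κ] {ι : κ → Type u} {V W : Type v} [AddCommGroup V] [Module ℝ V]
  [AddCommGroup W] [Module ℝ W]

theorem apply_comb (x : (i : κ) → ι i → V) (u : V →ₗ[ℝ] ℝ) (s : (i : κ) → Option (ι i))
    (m : κ → ℝ) : u (comb x s m) = ∑ i, m i * u (pick x s i) := by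
  simp [comb]

/-- Circuits in an avoiding transversal give vectors of a pointed cone in the plane, on which
the area form defines a transitive relation. -/
theorem area_trans {π : V →ₗ[ℝ] W} {g h : V} {a b : V →ₗ[ℝ] ℝ} (hc : PlaneCoords π g h a b)
    {x : (i : κ) → ι i → V} {s t₁ t₂ t₃ : (i : κ) → Option (ι i)} {l₁ l₂ l₃ : κ → ℝ}
    (hs : Avoids x s)
    (h₁ : IsCircuit π x t₁ l₁) (hs₁ : ∀ i ∈ colors t₁, s i = t₁ i)
    (h₂ : IsCircuit π x t₂ l₂) (hs₂ : ∀ i ∈ colors t₂, s i = t₂ i)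
    (h₃ : IsCircuit π x t₃ l₃) (hs₃ : ∀ i ∈ colors t₃, s i = t₃ i)
    (h12 : 0 ≤ area a b (comb x t₁ l₁) (comb x t₂ l₂))
    (h23 : 0 ≤ area a b (comb x t₂ l₂) (comb x t₃ l₃)) :
    0 ≤ area a b (comb x t₁ l₁) (comb x t₃ l₃) := by
  by_contra! h13
  have hrel := hc.area_relation h₁.map_comb h₂.map_comb h₃.map_comb
  rw [area_swap] at h13
  have hpos : 0 < area a b (comb x t₃ l₃) (comb x t₁ l₁) := by linarith
  simp only [comb_eq x hs₁ h₁.zero, comb_eq x hs₂ h₂.zero, comb_eq x hs₃ h₃.zero]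
    at hrel hpos h12 h23
  generalize area a b (comb x s l₂) (comb x s l₃) = A at *
  generalize area a b (comb x s l₃) (comb x s l₁) = B at *
  generalize area a b (comb x s l₁) (comb x s l₂) = C at *
  obtain ⟨i, hi⟩ := card_pos.1 (show 0 < #(colors t₂) by rw [h₂.card]; omega)
  have := hs (fun i => A * l₁ i + B * l₂ i + C * l₃ i) (fun i => by
    have := mul_nonneg h23 (h₁.nonneg i)
    have := mul_nonneg hpos.le (h₂.nonneg i)
    have := mul_nonneg h12 (h₃.nonneg i)
    positivity) (by
    rw [← hrel]
    simp only [comb, add_smul, sum_add_distrib, mul_smul, smul_sum]) i (colors_subset hs₂ hi)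
  have h1 := mul_nonneg h23 (h₁.nonneg i)
  have h2 := mul_pos hpos (h₂.pos i hi)
  have h3 := mul_nonneg h12 (h₃.nonneg i)
  linarith

/-- Exchange: if the vector of color `k` of `s` does not belong to the circuit `t`, there is a
circuit through it in which the other vectors belong to `t`. -/
theorem IsCircuit.exchange [FiniteDimensional ℝ W] {π : V →ₗ[ℝ] W} {x : (i : κ) → ι i → V}
    (hx' : Generic fun i j => π (x i j)) {s t : (i : κ) → Option (ι i)} {l : κ → ℝ}
    (ht : IsCircuit π x t l) (hst : ∀ i ∈ colors t, s i = t i) {k : κ} (hk : k ∈ colors s)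
    (hkt : k ∉ colors t) : ∃ t' l', IsCircuit π x t' l' ∧ (∀ i ∈ colors t', s i = t' i) ∧
      k ∈ colors t' ∧ ∀ i ∈ colors t', i = k ∨ i ∈ colors t := by
  classical
  obtain ⟨m, hm0, hm⟩ := hx'.exists_eq_sum (s := t) (by rw [ht.card]; omega) (-π (pick x s k))
  rw [sum_pick_map] at hm
  obtain ⟨i₀, hi₀, r, -, hr0, hr⟩ := exists_sub_mul_nonneg
    (card_pos.1 (by rw [ht.card]; omega)) m ht.pos
  have hi₀k : i₀ ≠ k := fun h => hkt (h ▸ hi₀)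
  set T := (insert k (colors t)).erase i₀ with hT
  have hTs : T ⊆ colors s := by
    intro i hi
    rcases mem_insert.1 (mem_of_mem_erase hi) with rfl | hi
    · exact hk
    · exact colors_subset hst hi
  have hTcard : #T = finrank ℝ W + 1 := by
    rw [hT, card_erase_of_mem (mem_insert_of_mem hi₀), card_insert_of_notMem hkt, ht.card]
    rfl
  set l' : κ → ℝ := fun i => if i = k then 1 else m i - r * l i with hl'
  have hl'k : l' k = 1 := by simp [hl']
  have hl'ne : ∀ i, i ≠ k → l' i = m i - r * l i := fun i hi => by simp [hl', hi]
  have hl'0 : ∀ i ∉ T, l' i = 0 := by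
    intro i hi
    by_cases hik : i = k
    · exact absurd (hik ▸ mem_erase.2 ⟨hi₀k.symm, mem_insert_self _ _⟩) hi
    · rw [hl'ne i hik]
      by_cases hi0 : i = i₀
      · rw [hi0, hr0]
      · have : i ∉ colors t := fun h => hi (mem_erase.2 ⟨hi0, mem_insert_of_mem h⟩)
        rw [hm0 i this, ht.zero i this]
        simp
  have hcomb : comb x s l' = pick x s k + (comb x t m - r • comb x t l) := by
    have e : ∀ i, l' i • pick x s i = (if i = k then pick x s k else 0) +
        (m i • pick x t i - r • l i • pick x t i) := by
      intro i
      by_cases hik : i = k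
      · subst hik
        simp [hl'k, hm0 _ hkt, ht.zero _ hkt]
      · rw [hl'ne i hik, if_neg hik]
        by_cases hi : i ∈ colors t
        · rw [pick_congr x (hst i hi)]
          module
        · simp [hm0 i hi, ht.zero i hi]
    simp only [comb, sum_congr rfl fun i _ => e i, sum_add_distrib, sum_sub_distrib, smul_sum]
    simp
  have hmap : π (comb x s l') = 0 := by
    rw [hcomb, map_add, map_sub, map_smul, ht.map_comb, comb, ← hm]
    simp
  have hnn : ∀ i ∈ T, 0 ≤ l' i := by
    intro i hi
    by_cases hik : i = k
    · rw [hik, hl'k]; exact zero_le_one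
    · rw [hl'ne i hik]
      exact hr i ((mem_insert.1 (mem_of_mem_erase hi)).resolve_left hik)
  have hkT : k ∈ T := mem_erase.2 ⟨hi₀k.symm, mem_insert_self _ _⟩
  refine ⟨restrict s T, l', ⟨?_, ?_, ?_, ?_⟩, ?_, ?_, ?_⟩
  · rw [colors_restrict s hTs, hTcard]
  · rw [colors_restrict s hTs]
    intro i hi
    refine (hnn i hi).lt_of_ne fun h0 => ?_
    -- A vanishing coefficient would leave a relation of at most `dim W` vectors.
    have h1 : l' k = 0 := by
      refine hx'.eq_zero (s := s) (T := T.erase i) ((erase_subset _ _).trans hTs)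
        (by rw [card_erase_of_mem hi, hTcard]; simp) ?_ ?_ k hk
      · intro j hj _
        by_cases hji : j = i
        · rw [hji, ← h0]
        · exact hl'0 j fun h => hj (mem_erase.2 ⟨hji, h⟩)
      · rw [sum_pick_map]; exact hmap
    rw [hl'k] at h1
    exact one_ne_zero h1
  · rw [colors_restrict s hTs]
    exact hl'0
  · rw [comb, sum_restrict x s fun i hi _ => hl'0 i hi]
    exact hmap
  · rw [colors_restrict s hTs]
    exact fun i hi => (restrict_of_mem s hi).symm
  · rwa [colors_restrict s hTs]
  · rw [colors_restrict s hTs]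
    exact fun i hi => mem_insert.1 (mem_of_mem_erase hi)

/-- Existence of the supporting circuit: take a circuit that is extreme for the area form. -/
theorem exists_isLifted [FiniteDimensional ℝ V] [FiniteDimensional ℝ W] [∀ i, Finite (ι i)]
    {π : V →ₗ[ℝ] W} (hdim : finrank ℝ V = finrank ℝ W + 2)
    {g h : V} {a b : V →ₗ[ℝ] ℝ} (hc : PlaneCoords π g h a b) {x : (i : κ) → ι i → V}
    (hx : Generic x) (hx' : Generic fun i j => π (x i j))
    {L : ((i : κ) → Option (ι i)) → κ → ℝ} {U : ((i : κ) → Option (ι i)) → V →ₗ[ℝ] ℝ}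
    (hLU : ∀ t, (∃ l, IsCircuit π x t l) → IsSupport π a b x t (L t) (U t))
    {s : (i : κ) → Option (ι i)} (hs : Avoids x s) (hs' : ¬ Avoids (fun i j => π (x i j)) s) :
    ∃ t, (∃ l, IsCircuit π x t l) ∧ IsLifted x t (U t) s := by
  classical
  have := Fintype.ofFinite (∀ i, Option (ι i))
  let F := univ.filter fun t : (i : κ) → Option (ι i) =>
    (∃ l, IsCircuit π x t l) ∧ ∀ i ∈ colors t, s i = t i
  have hF : F.Nonempty := by
    obtain ⟨T, hT, hcard, c, hpos, hzero, h0⟩ := hx'.caratheodory hs'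
    rw [sum_pick_map] at h0
    refine ⟨restrict s T, ?_⟩
    simp only [F, mem_filter, mem_univ, true_and]
    refine ⟨⟨c, ?_, ?_, ?_, ?_⟩, ?_⟩
    · rw [colors_restrict s hT, hcard]
    · rwa [colors_restrict s hT]
    · rwa [colors_restrict s hT]
    · rw [comb, sum_restrict x s fun i hi _ => hzero i hi, h0]
    · rw [colors_restrict s hT]
      exact fun i hi => (restrict_of_mem s hi).symm
  obtain ⟨t, ht, hmin⟩ := exists_least
    (fun p q => 0 ≤ area a b (comb x p (L p)) (comb x q (L q))) F hF
    (fun p q => by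
      rw [area_swap a b (comb x q (L q))]
      rcases le_total 0 (area a b (comb x p (L p)) (comb x q (L q))) with h | h
      · exact Or.inl h
      · exact Or.inr (by linarith))
    (fun p hp q hq r hr h1 h2 => by
      simp only [F, mem_filter, mem_univ, true_and] at hp hq hr
      exact area_trans hc hs (hLU p hp.1).circuit hp.2 (hLU q hq.1).circuit hq.2
        (hLU r hr.1).circuit hr.2 h1 h2)
  have hmem := ht
  simp only [F, mem_filter, mem_univ, true_and] at ht
  obtain ⟨hct, hst⟩ := ht
  have hu := hLU t hct
  refine ⟨t, hct, hst, fun k hk hkt => ?_⟩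
  by_contra! hneg
  have hne : U t (pick x s k) ≠ 0 := by
    intro h0
    apply hu.ne_zero
    have hsub : insert k (colors t) ⊆ colors s :=
      insert_subset hk (colors_subset hst)
    refine hx.functional_eq_zero (s := restrict s (insert k (colors t))) ?_ ?_
    · rw [colors_restrict s hsub, card_insert_of_notMem hkt, hu.circuit.card]
      omega
    · rw [colors_restrict s hsub]
      intro i hi
      rw [pick_congr x (restrict_of_mem s hi)]
      rcases mem_insert.1 hi with rfl | hi
      · exact h0
      · rw [pick_congr x (hst i hi), hu.vanish i hi]
  obtain ⟨t', l', hc', hst', hkt', hor⟩ := hu.circuit.exchange hx' hst hk hkt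
  have hu' := hLU t' ⟨l', hc'⟩
  have h1 := hmin t' (by
    simp only [F, mem_filter, mem_univ, true_and]
    exact ⟨⟨l', hc'⟩, hst'⟩)
  rw [← hu.eq_area _ hu'.circuit.map_comb, apply_comb, sum_eq_single k] at h1
  · rw [← pick_congr x (hst' k hkt')] at h1
    have := mul_neg_of_pos_of_neg (hu'.circuit.pos k hkt') (hneg.lt_of_ne hne)
    linarith
  · intro i _ hik
    by_cases hi : i ∈ colors t'
    · have hi' := (hor i hi).resolve_left hik
      rw [← pick_congr x (hst' i hi), pick_congr x (hst i hi'), hu.vanish i hi', mul_zero]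
    · rw [pick_of_notMem x hi, map_zero, mul_zero]
  · simp

/-- A transversal lifted from a circuit avoids the origin in `V` but not in `W`. -/
theorem IsLifted.avoids {π : V →ₗ[ℝ] W} (hdim : finrank ℝ V = finrank ℝ W + 2)
    {a b : V →ₗ[ℝ] ℝ} {x : (i : κ) → ι i → V} (hx : Generic x)
    {s t : (i : κ) → Option (ι i)} {l : κ → ℝ} {u : V →ₗ[ℝ] ℝ} (hu : IsSupport π a b x t l u)
    (hs : IsLifted x t u s) : Avoids x s ∧ ¬ Avoids (fun i j => π (x i j)) s := by
  constructor
  · intro c hc h0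
    have h1 : ∑ i, c i * u (pick x s i) = 0 := by
      have := congrArg u h0
      simpa using this
    have h2 : ∀ i ∉ colors t, i ∈ colors s → c i = 0 := by
      intro i hit hi
      have := (sum_eq_zero_iff_of_nonneg fun i _ =>
        mul_nonneg (hc i) (hs.nonneg hu i)).1 h1 i (mem_univ i)
      exact (mul_eq_zero.1 this).resolve_right (hs.2 i hi hit).ne'
    exact hx.eq_zero (colors_subset hs.1) (by rw [hu.circuit.card]; omega) h2 h0
  · intro h
    obtain ⟨i, hi⟩ := card_pos.1 (show 0 < #(colors t) by rw [hu.circuit.card]; omega)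
    refine (hu.circuit.pos i hi).ne' (h l hu.circuit.nonneg ?_ i (colors_subset hs.1 hi))
    rw [sum_pick_map]
    have := hu.circuit.map_comb
    rwa [comb_eq x hs.1 hu.circuit.zero] at this

/-- Every color that a circuit does not use has a vector on the positive side. -/
theorem IsSupport.exists_pos [FiniteDimensional ℝ V] [∀ i, Fintype (ι i)] {π : V →ₗ[ℝ] W}
    (hdim : finrank ℝ V = finrank ℝ W + 2) {a b : V →ₗ[ℝ] ℝ} {x : (i : κ) → ι i → V}
    (hx : Generic x) (hb : Balanced x) {t : (i : κ) → Option (ι i)} {l : κ → ℝ}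
    {u : V →ₗ[ℝ] ℝ} (hu : IsSupport π a b x t l u) {i : κ} (hi : i ∉ colors t) :
    ∃ j, 0 < u (x i j) := by
  classical
  have hne : ∃ j, u (x i j) ≠ 0 := by
    by_contra! h0
    apply hu.ne_zero
    obtain ⟨⟨j⟩, -⟩ := hb i
    have hcol : colors (Function.update t i (some j)) = insert i (colors t) := by
      ext k
      by_cases hk : k = i
      · subst hk; simp [mem_colors]
      · simp [mem_colors, hk]
    refine hx.functional_eq_zero (s := Function.update t i (some j)) ?_ ?_
    · rw [hcol, card_insert_of_notMem hi, hu.circuit.card]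
      omega
    · intro k hk
      by_cases hki : k = i
      · subst hki; simp [pick, h0]
      · have : Function.update t i (some j) k = t k := by simp [hki]
        rw [pick_congr x this, hu.vanish]
        rw [hcol] at hk
        exact (mem_insert.1 hk).resolve_left hki
  obtain ⟨j, hj⟩ := hne
  exact hb.exists_pos u hj

open Classical in
/-- The transversals lifted from `t` form a product of sets, over which the sign sums to a
product of numbers `m i - 1`, with `m i` the number of vectors of color `i` on the positive side. -/
theorem sum_isLifted_nonneg [∀ i, Fintype (ι i)] {x : (i : κ) → ι i → V}
    {t : (i : κ) → Option (ι i)} {u : V →ₗ[ℝ] ℝ} (h : ∀ i ∉ colors t, ∃ j, 0 < u (x i j)) :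
    0 ≤ ∑ s : (i : κ) → Option (ι i), if IsLifted x t u s then sgn s else 0 := by
  let A : (i : κ) → Finset (Option (ι i)) := fun i => univ.filter fun o =>
    (i ∈ colors t → o = t i) ∧ (o ≠ none → i ∉ colors t → 0 < u (o.elim 0 (x i)))
  have hA : (univ.filter fun s : (i : κ) → Option (ι i) => IsLifted x t u s) =
      Fintype.piFinset A := by
    ext s
    simp only [mem_filter, mem_univ, true_and, Fintype.mem_piFinset, IsLifted, A, forall_and,
      mem_colors, pick]
  rw [← sum_filter, hA]
  unfold sgn
  rw [← prod_univ_sum A fun i o => o.elim (-1) fun _ => (1 : ℤ)]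
  refine prod_nonneg fun i _ => ?_
  by_cases hi : i ∈ colors t
  · refine sum_nonneg fun o ho => ?_
    simp only [A, mem_filter, mem_univ, true_and] at ho
    have := mem_colors.1 hi
    rw [← ho.1 hi] at this
    obtain ⟨j, rfl⟩ := Option.ne_none_iff_exists'.1 this
    simp
  · obtain ⟨j₁, hj₁⟩ := h i hi
    rw [sum_filter, Fintype.sum_option]
    simp only [hi, ne_eq, not_false_eq_true, false_implies, true_implies, not_true_eq_false,
      and_self, if_true, Option.elim_none, Option.elim_some, true_and, reduceCtorEq]
    have : (1 : ℤ) ≤ ∑ j, if 0 < u (x i j) then 1 else 0 := by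
      rw [← sum_filter, sum_const, nsmul_eq_mul, mul_one]
      exact_mod_cast card_pos.2 ⟨j₁, by simpa using hj₁⟩
    linarith

theorem avoids_of_avoids_map (π : V →ₗ[ℝ] W) (x : (i : κ) → ι i → V)
    {s : (i : κ) → Option (ι i)} (hs : Avoids (fun i j => π (x i j)) s) : Avoids x s :=
  fun c hc h0 => hs c hc (by rw [sum_pick_map, h0, map_zero])

/-- Projecting along a generic plane does not increase the signed number of avoiding
transversals. -/
theorem avoidingSum_map_le [FiniteDimensional ℝ V] [FiniteDimensional ℝ W] [∀ i, Fintype (ι i)]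
    {π : V →ₗ[ℝ] W} (hπ : Function.Surjective π) (hdim : finrank ℝ V = finrank ℝ W + 2)
    {x : (i : κ) → ι i → V} (hx : Generic x) (hx' : Generic fun i j => π (x i j))
    (hb : Balanced x) : avoidingSum (fun i j => π (x i j)) ≤ avoidingSum x := by
  classical
  obtain ⟨g, h, a, b, hc⟩ := exists_planeCoords hπ hdim
  have hex : ∀ t : (i : κ) → Option (ι i), ∃ (l : κ → ℝ) (u : V →ₗ[ℝ] ℝ),
      (∃ l, IsCircuit π x t l) → IsSupport π a b x t l u := by
    intro t
    by_cases ht : ∃ l, IsCircuit π x t l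
    · obtain ⟨l, hl⟩ := ht
      obtain ⟨u, hu⟩ := exists_isSupport hπ hdim hc hx hx' hl
      exact ⟨l, u, fun _ => hu⟩
    · exact ⟨0, 0, fun h => absurd h ht⟩
  choose L U hLU using hex
  rw [← sub_nonneg, avoidingSum, avoidingSum, ← sum_sub_distrib]
  have key : ∀ s : (i : κ) → Option (ι i),
      ((if Avoids x s then sgn s else 0) -
        if Avoids (fun i j => π (x i j)) s then sgn s else 0) =
      ∑ t ∈ univ.filter (fun t : (i : κ) → Option (ι i) => ∃ l, IsCircuit π x t l),
        if IsLifted x t (U t) s then sgn s else 0 := by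
    intro s
    by_cases hs : Avoids x s ∧ ¬ Avoids (fun i j => π (x i j)) s
    · obtain ⟨t, ht, hts⟩ := exists_isLifted hdim hc hx hx' hLU hs.1 hs.2
      rw [sum_eq_single t]
      · simp [hs.1, hs.2, hts]
      · intro t' ht' hne
        rw [if_neg]
        intro hts'
        simp only [mem_filter, mem_univ, true_and] at ht'
        exact hne (hts'.unique (hLU t' ht') (hLU t ht) hts)
      · intro h
        exact absurd (by simpa using ht) h
    · rw [sum_eq_zero]
      · by_cases h1 : Avoids x s
        · have h2 : Avoids (fun i j => π (x i j)) s := by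
            by_contra h2
            exact hs ⟨h1, h2⟩
          simp [h1, h2]
        · have h2 : ¬ Avoids (fun i j => π (x i j)) s := fun h2 => h1 (avoids_of_avoids_map π x h2)
          simp [h1, h2]
      · intro t ht
        rw [if_neg]
        intro hts
        simp only [mem_filter, mem_univ, true_and] at ht
        exact hs (hts.avoids hdim hx (hLU t ht))
  rw [sum_congr rfl fun s _ => key s, sum_comm]
  refine sum_nonneg fun t ht => ?_
  simp only [mem_filter, mem_univ, true_and] at ht
  exact sum_isLifted_nonneg fun i hi => (hLU t ht).exists_pos hdim hx hb hi

end Sweep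

end ColorfulDepth

/-! ### The bound for generic families -/

namespace ColorfulDepth

open Finset Module

section Count

variable {κ : Type*} [Fintype κ] {ι : κ → Type u} [∀ i, Fintype (ι i)]

/-- A generic family stays generic under projection along a generic line. -/
theorem Generic.exists_quotient {V : Type v} [AddCommGroup V] [Module ℝ V]
    [FiniteDimensional ℝ V] {x : (i : κ) → ι i → V} (hx : Generic x) {k : ℕ}
    (hk : finrank ℝ V = k + 1) : ∃ g : V, finrank ℝ (V ⧸ Submodule.span ℝ {g}) = k ∧
      Generic fun i j => (Submodule.span ℝ {g}).mkQ (x i j) := by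
  classical
  let F : Finset (Submodule ℝ V) := (univ.filter fun s : (i : κ) → Option (ι i) =>
    #(colors s) ≤ k).image fun s => Submodule.span ℝ ((fun i => pick x s i) '' (colors s : Set κ))
  have hF : (⊤ : Submodule ℝ V) ∉ F := by
    intro h
    simp only [F, mem_image, mem_filter, mem_univ, true_and] at h
    obtain ⟨s, hs, htop⟩ := h
    exact (span_pick_lt_top x (t := s) (by omega)).ne htop
  obtain ⟨g, hg⟩ := (Set.ne_univ_iff_exists_notMem _).1 (Subspace.biUnion_ne_univ_of_top_notMem hF)
  simp only [Set.mem_iUnion, not_exists] at hg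
  have hg' : ∀ s : (i : κ) → Option (ι i), #(colors s) ≤ k →
      g ∉ Submodule.span ℝ ((fun i => pick x s i) '' (colors s : Set κ)) := fun s hs =>
    hg _ (mem_image_of_mem _ (by simpa using hs))
  have hg0 : g ≠ 0 := by
    rintro rfl
    exact hg' (fun _ => none) (by simp [colors]) (Submodule.zero_mem _)
  have hrank : finrank ℝ (V ⧸ Submodule.span ℝ {g}) = k := by
    have h1 := (Submodule.span ℝ {g}).finrank_quotient_add_finrank
    rw [finrank_span_singleton hg0, hk] at h1
    omega
  refine ⟨g, hrank, fun s hs c h0 => ?_⟩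
  rw [hrank] at hs
  rw [sum_pick_map, Submodule.mkQ_apply, Submodule.Quotient.mk_eq_zero,
    Submodule.mem_span_singleton] at h0
  obtain ⟨r, hr⟩ := h0
  have hr0 : r = 0 := by
    by_contra hr0
    apply hg' s hs
    have : g = r⁻¹ • ∑ i, c i • pick x s i := by rw [← hr, smul_smul, inv_mul_cancel₀ hr0, one_smul]
    rw [this]
    refine Submodule.smul_mem _ _ (Submodule.sum_mem _ fun i _ => Submodule.smul_mem _ _ ?_)
    by_cases hi : i ∈ colors s
    · exact Submodule.subset_span ⟨i, hi, rfl⟩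
    · rw [pick_of_notMem x hi]; exact Submodule.zero_mem _
  rw [hr0, zero_smul] at hr
  exact hx s (by omega) c hr.symm

theorem colors_eq_empty {s : (i : κ) → Option (ι i)} (h : colors s = ∅) : s = fun _ => none := by
  funext i
  by_contra hi
  have : i ∈ colors s := mem_colors.2 hi
  simp [h] at this

theorem colors_none : colors (fun _ => none : (i : κ) → Option (ι i)) = ∅ := by
  simp [colors]

theorem sgn_none : sgn (fun _ => none : (i : κ) → Option (ι i)) = (-1) ^ Fintype.card κ := by
  simp [sgn]

theorem avoidingSum_of_finrank_eq_zero {V : Type v} [AddCommGroup V] [Module ℝ V]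
    [FiniteDimensional ℝ V] (h : finrank ℝ V = 0) (x : (i : κ) → ι i → V) :
    avoidingSum x = (-1) ^ Fintype.card κ := by
  classical
  have := finrank_zero_iff.1 h
  rw [avoidingSum, sum_eq_single fun _ => none, if_pos, sgn_none]
  · intro c _ _ i hi
    simp [colors_none] at hi
  · intro s _ hs
    rw [if_neg]
    intro ha
    apply hs
    refine colors_eq_empty (eq_empty_of_forall_notMem fun i hi => ?_)
    exact one_ne_zero (ha (fun _ => 1) (fun _ => zero_le_one) (Subsingleton.elim _ _) i hi)
  · simp

/-- On a line, a set of nonzero vectors avoids the origin if it lies on one side. -/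
theorem avoidingSum_of_finrank_eq_one {V : Type v} [AddCommGroup V] [Module ℝ V]
    [FiniteDimensional ℝ V] (h : finrank ℝ V = 1) {x : (i : κ) → ι i → V} (hx : Generic x)
    (hb : Balanced x) : (-1) ^ (Fintype.card κ + 1) ≤ avoidingSum x := by
  classical
  let e : V ≃ₗ[ℝ] ℝ := LinearEquiv.ofFinrankEq V ℝ (by rw [h, finrank_self])
  let u : V →ₗ[ℝ] ℝ := e
  have hu : ∀ v, u v = 0 → v = 0 := fun v hv => e.map_eq_zero_iff.1 hv
  have hne : ∀ (s : (i : κ) → Option (ι i)), ∀ i ∈ colors s, u (pick x s i) ≠ 0 := by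
    intro s i hi h0
    have := hx.eq_zero (s := restrict s {i}) (T := {i}) (c := fun k => if k = i then 1 else 0)
      (by rw [colors_restrict s (by simpa using hi)]) (by simp [h])
      (fun k hk _ => by simpa using hk) (by
        simp [pick_congr x (restrict_of_mem s (mem_singleton_self i)), hu _ h0]) i
      (by rw [colors_restrict s (by simpa using hi)]; simp)
    simp at this
  have hpos : ∀ v : V →ₗ[ℝ] ℝ, (∀ s : (i : κ) → Option (ι i), ∀ i ∈ colors s,
      v (pick x s i) ≠ 0) → ∀ i, ∃ j, 0 < v (x i j) := by
    intro v hv i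
    obtain ⟨⟨j⟩, -⟩ := hb i
    refine hb.exists_pos v (j := j) ?_
    have := hv (Function.update (fun _ => none) i (some j)) i (by simp [mem_colors])
    simpa [pick] using this
  have h1 := sum_isLifted_nonneg (x := x) (t := fun _ => none) (u := u) fun i _ => hpos u hne i
  have h2 := sum_isLifted_nonneg (x := x) (t := fun _ => none) (u := -u) fun i _ =>
    hpos (-u) (fun s i hi => by simpa using hne s i hi) i
  have h3 : ∑ s : (i : κ) → Option (ι i), (if s = fun _ => none then sgn s else 0) =
      (-1) ^ Fintype.card κ := by
    rw [sum_ite_eq' univ (fun _ => none) sgn, if_pos (mem_univ _), sgn_none]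
  have key : ∀ s : (i : κ) → Option (ι i), (if Avoids x s then sgn s else 0) =
      (if IsLifted x (fun _ => none) u s then sgn s else 0) +
      (if IsLifted x (fun _ => none) (-u) s then sgn s else 0) -
      if s = fun _ => none then sgn s else 0 := by
    intro s
    have e1 : ∀ v : V →ₗ[ℝ] ℝ, IsLifted x (fun _ => none) v s ↔
        ∀ i ∈ colors s, 0 < v (pick x s i) := by
      intro v
      simp [IsLifted, colors_none]
    have hav : ∀ v : V →ₗ[ℝ] ℝ, (∀ i ∈ colors s, 0 < v (pick x s i)) → Avoids x s := by
      intro v hv c hc h0 i hi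
      have h1 : ∑ i, c i * v (pick x s i) = 0 := by
        have := congrArg v h0
        simpa using this
      have := (sum_eq_zero_iff_of_nonneg fun k _ => mul_nonneg (hc k) (by
        by_cases hk : k ∈ colors s
        · exact (hv k hk).le
        · simp [pick_of_notMem x hk])).1 h1 i (mem_univ i)
      exact (mul_eq_zero.1 this).resolve_right (hv i hi).ne'
    by_cases hs : s = fun _ => none
    · have hc : colors s = ∅ := by rw [hs, colors_none]
      have ha : Avoids x s := hav u (by simp [hc])
      rw [if_pos ha, if_pos ((e1 u).2 (by simp [hc])), if_pos ((e1 (-u)).2 (by simp [hc])),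
        if_pos hs]
      ring
    · rw [if_neg hs, sub_zero]
      obtain ⟨i₀, hi₀⟩ : (colors s).Nonempty := by
        rw [nonempty_iff_ne_empty]
        exact fun h => hs (colors_eq_empty h)
      by_cases hp : ∀ i ∈ colors s, 0 < u (pick x s i)
      · have hn : ¬ ∀ i ∈ colors s, 0 < (-u) (pick x s i) := by
          intro hn
          have h1 := hp i₀ hi₀
          have h2 := hn i₀ hi₀
          rw [LinearMap.neg_apply] at h2
          linarith
        rw [if_pos (hav u hp), if_pos ((e1 u).2 hp), if_neg fun h => hn ((e1 _).1 h), add_zero]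
      · by_cases hn : ∀ i ∈ colors s, 0 < (-u) (pick x s i)
        · rw [if_pos (hav _ hn), if_pos ((e1 _).2 hn), if_neg fun h => hp ((e1 _).1 h), zero_add]
        · rw [if_neg fun h => hp ((e1 _).1 h), if_neg fun h => hn ((e1 _).1 h), add_zero, if_neg]
          intro ha
          push Not at hp hn
          obtain ⟨i, hi, hip⟩ := hp
          obtain ⟨k, hk, hkn⟩ := hn
          have hip := hip.lt_of_ne (hne s i hi)
          have hkn : 0 < u (pick x s k) := by
            rw [LinearMap.neg_apply] at hkn
            exact (by linarith : 0 ≤ u (pick x s k)).lt_of_ne' (hne s k hk)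
          have hik : i ≠ k := by rintro rfl; linarith
          have := ha (fun l => (if l = i then u (pick x s k) else 0) +
            if l = k then -u (pick x s i) else 0) (fun l => by
              apply add_nonneg
              · split_ifs
                · exact hkn.le
                · exact le_rfl
              · split_ifs
                · linarith
                · exact le_rfl) (hu _ (by
                simp only [add_smul, sum_add_distrib, ite_smul, zero_smul, sum_ite_eq', mem_univ,
                  if_true, map_add, map_smul, smul_eq_mul]
                ring)) i hi
          simp [hik] at this
          linarith
  rw [avoidingSum, sum_congr rfl fun s _ => key s, sum_sub_distrib, sum_add_distrib, h3, pow_succ]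
  linarith

/-- The lower bound for the signed number of avoiding transversals of a generic balanced family in
dimension `k`, by induction in steps of two. -/
theorem le_avoidingSum (k : ℕ) : ∀ {V : Type v} [AddCommGroup V] [Module ℝ V]
    [FiniteDimensional ℝ V] {x : (i : κ) → ι i → V}, finrank ℝ V = k → Generic x → Balanced x →
    (-1) ^ (Fintype.card κ + k) ≤ avoidingSum x := by
  induction k using Nat.twoStepInduction with
  | zero =>
    intro V _ _ _ x h _ _
    rw [avoidingSum_of_finrank_eq_zero h, add_zero]
  | one =>
    intro V _ _ _ x h hx hb
    exact avoidingSum_of_finrank_eq_one h hx hb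
  | more k ih _ =>
    intro V _ _ _ x h hx hb
    obtain ⟨g, hg, hxg⟩ := hx.exists_quotient h
    obtain ⟨g', hg', hxg'⟩ := hxg.exists_quotient hg
    let π := (Submodule.span ℝ {g'}).mkQ ∘ₗ (Submodule.span ℝ {g}).mkQ
    have h1 := ih hg' hxg' (hb.map π)
    have h2 := avoidingSum_map_le (π := π)
      ((Submodule.mkQ_surjective _).comp (Submodule.mkQ_surjective _)) (by rw [h, hg']) hx hxg' hb
    refine le_trans (le_of_eq ?_) (h1.trans h2)
    rw [← add_assoc, pow_add _ _ 2]
    norm_num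

open Classical in
/-- The bound for generic balanced families of vectors. -/
theorem card_not_avoids_le {V : Type v} [AddCommGroup V] [Module ℝ V] [FiniteDimensional ℝ V]
    {x : (i : κ) → ι i → V} (hκ : Fintype.card κ = finrank ℝ V + 1) (hx : Generic x)
    (hb : Balanced x) :
    #(univ.filter fun t : (i : κ) → ι i => ¬ Avoids x fun i => some (t i)) ≤
      1 + ∏ i, (Fintype.card (ι i) - 1) := by
  have h1 := le_avoidingSum _ rfl hx hb
  have htot : ∑ s : (i : κ) → Option (ι i), sgn s = ((∏ i, (Fintype.card (ι i) - 1) : ℕ) : ℤ) := by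
    have := prod_univ_sum (fun i => (univ : Finset (Option (ι i))))
      fun i o => o.elim (-1) fun _ => (1 : ℤ)
    rw [Fintype.piFinset_univ] at this
    unfold sgn
    rw [← this, Nat.cast_prod]
    refine prod_congr rfl fun i _ => ?_
    have := Fintype.card_pos_iff.2 (hb i).1
    rw [Fintype.sum_option]
    simp only [Option.elim_none, Option.elim_some, sum_const, card_univ, nsmul_eq_mul, mul_one]
    push_cast [Nat.cast_sub (show 1 ≤ Fintype.card (ι i) from this)]
    ring
  have hcount : ∑ s : (i : κ) → Option (ι i), (if ¬ Avoids x s then sgn s else 0) =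
      #(univ.filter fun t : (i : κ) → ι i => ¬ Avoids x fun i => some (t i)) := by
    rw [← sum_filter, card_eq_sum_ones, Nat.cast_sum]
    symm
    refine sum_bij (fun t _ i => some (t i)) ?_ ?_ ?_ ?_
    · intro t ht
      simpa using ht
    · intro t _ t' _ h
      funext i
      exact Option.some_injective _ (congrFun h i)
    · intro s hs
      have hfull : ∀ i, s i ≠ none := by
        by_contra! h
        obtain ⟨i, hi⟩ := h
        have hlt : #(colors s) < Fintype.card κ :=
          card_lt_univ_of_notMem (x := i) fun h => mem_colors.1 h hi
        simp only [mem_filter, mem_univ, true_and] at hs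
        exact hs fun c _ h0 => hx s (by omega) c h0
      choose t ht using fun i => Option.ne_none_iff_exists'.1 (hfull i)
      have hts : (fun i => some (t i)) = s := funext fun i => (ht i).symm
      exact ⟨t, by simpa [hts] using hs, hts⟩
    · intro t _
      simp [sgn]
  have hsplit : avoidingSum x + ∑ s : (i : κ) → Option (ι i), (if ¬ Avoids x s then sgn s else 0) =
      ∑ s : (i : κ) → Option (ι i), sgn s := by
    rw [avoidingSum, ← sum_add_distrib]
    refine sum_congr rfl fun s _ => ?_
    by_cases h : Avoids x s <;> simp [h]
  rw [htot, hcount] at hsplit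
  have hsign : (-1 : ℤ) ^ (Fintype.card κ + finrank ℝ V) = -1 := by
    rw [hκ]
    exact Odd.neg_one_pow ⟨finrank ℝ V, by ring⟩
  rw [hsign] at h1
  have : (#(univ.filter fun t : (i : κ) → ι i => ¬ Avoids x fun i => some (t i)) : ℤ) ≤
      1 + ((∏ i, (Fintype.card (ι i) - 1) : ℕ) : ℤ) := by linarith
  exact_mod_cast this

end Count

end ColorfulDepth

/-! ### Hitting simplices and linear relations -/

namespace ColorfulDepth

open Finset Module

section Hull

variable {E : Type*} [AddCommGroup E] [Module ℝ E]

theorem zero_mem_convexHull_range {A : Type*} [Fintype A] {f : A → E}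
    (h : (0 : E) ∈ convexHull ℝ (Set.range f)) :
    ∃ w : A → ℝ, (∀ i, 0 ≤ w i) ∧ ∑ i, w i = 1 ∧ ∑ i, w i • f i = 0 := by
  classical
  rw [convexHull_range_eq_exists_affineCombination] at h
  obtain ⟨s, w, hw, hsum, h0⟩ := h
  rw [s.affineCombination_eq_linear_combination _ _ hsum] at h0
  refine ⟨fun i => if i ∈ s then w i else 0, fun i => ?_, ?_, ?_⟩
  · by_cases hi : i ∈ s
    · simpa [hi] using hw i hi
    · simp [hi]
  · simpa using hsum
  · simpa using h0

/-- A set whose convex hull contains the origin lies in the direction of its affine span. -/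
theorem subset_vectorSpan {P : Set E} (h : (0 : E) ∈ convexHull ℝ P) :
    P ⊆ (vectorSpan ℝ P : Set E) := by
  intro p hp
  have := vsub_mem_vectorSpan_of_mem_affineSpan_of_mem_affineSpan (subset_affineSpan ℝ P hp)
    (convexHull_subset_affineSpan P h)
  simpa using this

theorem vectorSpan_le_span (P : Set E) : vectorSpan ℝ P ≤ Submodule.span ℝ P := by
  rw [vectorSpan_def, Submodule.span_le]
  rintro _ ⟨p, hp, q, hq, rfl⟩
  exact Submodule.sub_mem _ (Submodule.subset_span hp) (Submodule.subset_span hq)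

end Hull

section Hitting

variable {d : ℕ} {ι : Fin (d + 1) → Type u}

/-- The vertices of the transversal `t` with colors in `T`. -/
def vertices (t : (i : Fin (d + 1)) → ι i) (T : Finset (Fin (d + 1))) :
    Finset ((i : Fin (d + 1)) × ι i) :=
  T.map ⟨fun i => ⟨i, t i⟩, fun _ _ h => (Sigma.mk.inj_iff.1 h).1⟩

theorem mem_vertices {t : (i : Fin (d + 1)) → ι i} {T : Finset (Fin (d + 1))}
    {p : (i : Fin (d + 1)) × ι i} : p ∈ vertices t T ↔ ∃ i ∈ T, ⟨i, t i⟩ = p := by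
  simp only [vertices, mem_map]
  rfl

theorem isColorful_vertices (t : (i : Fin (d + 1)) → ι i) (T : Finset (Fin (d + 1))) :
    IsColorful (vertices t T) := by
  intro p hp q hq h
  obtain ⟨i, -, rfl⟩ := mem_vertices.1 hp
  obtain ⟨k, -, rfl⟩ := mem_vertices.1 hq
  obtain rfl : i = k := h
  rfl

theorem vertices_univ_injective :
    Function.Injective fun t : (i : Fin (d + 1)) → ι i => vertices t univ := by
  intro t t' h
  funext i
  have : (⟨i, t i⟩ : (i : Fin (d + 1)) × ι i) ∈ vertices t' univ := by
    rw [← show vertices t univ = vertices t' univ from h]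
    exact mem_vertices.2 ⟨i, mem_univ i, rfl⟩
  obtain ⟨k, -, hk⟩ := mem_vertices.1 this
  obtain ⟨rfl, hk⟩ := Sigma.mk.inj_iff.1 hk
  exact (eq_of_heq hk).symm

theorem points_vertices (C : (i : Fin (d + 1)) → ι i → EuclideanSpace ℝ (Fin d))
    (t : (i : Fin (d + 1)) → ι i) (T : Finset (Fin (d + 1))) :
    points C (vertices t T) = (fun i => C i (t i)) '' (T : Set (Fin (d + 1))) := by
  ext y
  simp only [points, Set.mem_image, mem_coe, mem_vertices]
  constructor
  · rintro ⟨_, ⟨i, hi, rfl⟩, rfl⟩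
    exact ⟨i, hi, rfl⟩
  · rintro ⟨i, hi, rfl⟩
    exact ⟨_, ⟨i, hi, rfl⟩, rfl⟩

/-- A colorful simplex with `d + 1` vertices uses every color. -/
theorem IsColorful.exists_eq_vertices {S : Finset ((i : Fin (d + 1)) × ι i)} (hS : IsColorful S)
    (hcard : #S = d + 1) : ∃ t, S = vertices t univ := by
  classical
  have himg : S.image Sigma.fst = univ := by
    rw [← card_eq_iff_eq_univ, card_image_of_injOn, hcard, Fintype.card_fin]
    exact fun p hp q hq h => hS p hp q hq h
  have hex : ∀ i, ∃ j : ι i, (⟨i, j⟩ : (i : Fin (d + 1)) × ι i) ∈ S := by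
    intro i
    have : i ∈ S.image Sigma.fst := by rw [himg]; exact mem_univ i
    obtain ⟨⟨k, j⟩, hj, rfl⟩ := mem_image.1 this
    exact ⟨j, hj⟩
  choose t ht using hex
  refine ⟨t, (eq_of_subset_of_card_le (fun p hp => ?_) ?_).symm⟩
  · obtain ⟨i, -, rfl⟩ := mem_vertices.1 hp
    exact ht i
  · simp [vertices, hcard]

/-- In relative general position, the origin is in the interior of every hitting simplex. -/
theorem IsHitting.exists_relation {C : (i : Fin (d + 1)) → ι i → EuclideanSpace ℝ (Fin d)}
    (hC : InRelativeGeneralPosition C) {S : Finset ((i : Fin (d + 1)) × ι i)}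
    (hS : IsHitting C S) : ∃ t, S = vertices t univ ∧ (∃ c : Fin (d + 1) → ℝ, (∀ i, 0 < c i) ∧
      ∑ i, c i • C i (t i) = 0) ∧ LinearIndependent ℝ fun i : Fin d => C i.succ (t i.succ) := by
  obtain ⟨hcol, hdim, hcard, h0⟩ := hS
  obtain ⟨t, rfl⟩ := hcol.exists_eq_vertices hcard
  refine ⟨t, rfl, ?_⟩
  have hp : points C (vertices t univ) = Set.range fun i => C i (t i) := by
    rw [points_vertices, coe_univ, Set.image_univ]
  rw [dim, hp] at hdim
  rw [hp] at h0
  have hai : AffineIndependent ℝ fun i => C i (t i) :=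
    (affineIndependent_iff_finrank_vectorSpan_eq ℝ _ (by simp)).2 hdim
  obtain ⟨c, hc, hc1, hc0⟩ := zero_mem_convexHull_range h0
  have hpos : ∀ i, 0 < c i := by
    intro k
    refine (hc k).lt_of_ne' fun hk => ?_
    have hk1 : ∑ i ∈ univ.erase k, c i = 1 := by
      rw [← hc1, ← add_sum_erase univ c (mem_univ k), hk, zero_add]
    have hk0 : ∑ i ∈ univ.erase k, c i • C i (t i) = 0 := by
      rw [← hc0, ← add_sum_erase univ _ (mem_univ k), hk, zero_smul, zero_add]
    -- In dimension `0` a vanishing coefficient contradicts the sum being `1`.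
    have hd : d ≠ 0 := by
      rintro rfl
      have : (univ : Finset (Fin (0 + 1))).erase k = ∅ := by
        rw [← card_eq_zero, card_erase_of_mem (mem_univ k), card_univ, Fintype.card_fin]
      rw [this, sum_empty] at hk1
      exact zero_ne_one hk1
    obtain ⟨e, rfl⟩ := Nat.exists_eq_succ_of_ne_zero hd
    refine hC (vertices t (univ.erase k)) (isColorful_vertices _ _) ?_ ?_
    · classical
      have := hai.finrank_vectorSpan_image_finset (s := univ.erase k) (n := e) (by simp)
      rw [coe_image] at this
      rw [dim, points_vertices, this]
    · rw [points_vertices, ← hk0]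
      exact (convex_convexHull ℝ _).sum_mem (fun i _ => hc i) hk1
        fun i hi => subset_convexHull ℝ _ ⟨i, hi, rfl⟩
  refine ⟨⟨c, hpos, hc0⟩, ?_⟩
  refine linearIndependent_of_top_le_span_of_card_eq_finrank ?_ (by simp)
  have htop : vectorSpan ℝ (Set.range fun i => C i (t i)) = ⊤ :=
    Submodule.eq_top_of_finrank_eq (by rw [hdim]; simp)
  rw [← htop]
  refine (vectorSpan_le_span _).trans (Submodule.span_le.2 ?_)
  rintro _ ⟨i, rfl⟩
  refine Fin.cases ?_ (fun i => ?_) i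
  · have : C 0 (t 0) = (c 0)⁻¹ • -∑ i : Fin d, c i.succ • C i.succ (t i.succ) := by
      rw [Fin.sum_univ_succ] at hc0
      rw [← eq_neg_of_add_eq_zero_left hc0, smul_smul, inv_mul_cancel₀ (hpos 0).ne', one_smul]
    change C 0 (t 0) ∈ _
    rw [this]
    exact Submodule.smul_mem _ _ (Submodule.neg_mem _ (Submodule.sum_mem _ fun i _ =>
      Submodule.smul_mem _ _ (Submodule.subset_span ⟨i, rfl⟩)))
  · exact Submodule.subset_span ⟨i, rfl⟩

/-- A point in the relative interior of the convex hull of a finite set is a combination of all its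
points with positive coefficients. -/
theorem IsCentered.balanced [∀ i, Fintype (ι i)]
    {C : (i : Fin (d + 1)) → ι i → EuclideanSpace ℝ (Fin d)} (hC : IsCentered C) :
    Balanced C := by
  intro i
  have hi := hC i
  have h0 := intrinsicInterior_subset hi
  have hne : Nonempty (ι i) := by
    rw [← Set.range_nonempty_iff_nonempty (f := C i), ← convexHull_nonempty_iff (𝕜 := ℝ)]
    exact ⟨_, h0⟩
  refine ⟨hne, ?_⟩
  set m : ℝ := (Fintype.card (ι i) : ℝ) with hm
  have hm0 : 0 < m := by
    rw [hm]; exact_mod_cast Fintype.card_pos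
  -- The barycenter; the hull contains a small negative multiple of it.
  set q : EuclideanSpace ℝ (Fin d) := ∑ j, m⁻¹ • C i j with hq
  have hqmem : q ∈ convexHull ℝ (Set.range (C i)) :=
    (convex_convexHull ℝ _).sum_mem (fun _ _ => (inv_pos.2 hm0).le)
      (by simp [← hm, hm0.ne']) fun j _ => subset_convexHull ℝ _ ⟨j, rfl⟩
  obtain ⟨⟨y, hy⟩, hint, rfl⟩ := mem_intrinsicInterior.1 hi
  have hline : ∀ r : ℝ, -(r • q) ∈ affineSpan ℝ (convexHull ℝ (Set.range (C i))) := by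
    intro r
    have := AffineMap.lineMap_mem (-r) hy (subset_affineSpan ℝ _ hqmem)
    simpa [AffineMap.lineMap_apply] using this
  let f : ℝ → affineSpan ℝ (convexHull ℝ (Set.range (C i))) := fun r => ⟨-(r • q), hline r⟩
  have hf : Continuous f := by
    refine Continuous.subtype_mk ?_ _
    fun_prop
  have hnhds := hf.continuousAt.preimage_mem_nhds (x := 0)
    (mem_interior_iff_mem_nhds.1 (by
      have : f 0 = ⟨0, hy⟩ := Subtype.ext (by simp [f])
      rw [this]
      exact hint))
  obtain ⟨ε, hε, hball⟩ := Metric.mem_nhds_iff.1 hnhds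
  have hmem : -((ε / 2) • q) ∈ convexHull ℝ (Set.range (C i)) :=
    hball (show ε / 2 ∈ Metric.ball 0 ε by
      rw [Metric.mem_ball, dist_zero_right, Real.norm_eq_abs, abs_of_pos (by linarith)]
      linarith)
  rw [convexHull_range_eq_exists_affineCombination] at hmem
  classical
  obtain ⟨s, w, hw, hsum, hwq⟩ := hmem
  rw [s.affineCombination_eq_linear_combination _ _ hsum] at hwq
  refine ⟨fun j => (if j ∈ s then w j else 0) + ε / 2 * m⁻¹, fun j => ?_, ?_⟩
  · have : 0 < ε / 2 * m⁻¹ := by positivity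
    by_cases hj : j ∈ s
    · have := hw j hj
      simp only [hj, if_true]
      linarith
    · simp only [hj, if_false]
      linarith
  · simp only [add_smul, sum_add_distrib, mul_smul, ← smul_sum]
    rw [smul_sum (r := m⁻¹), ← hq]
    have : ∑ j, (if j ∈ s then w j else 0) • C i j = ∑ j ∈ s, w j • C i j := by
      simp
    rw [this, hwq]
    simp

end Hitting

end ColorfulDepth

/-! ### Generic directions and perturbation -/

namespace ColorfulDepth

open Finset Module Filter Topology

section Simplex

/-- The vertices `-∑ eᵢ, e₁, …, e_d` of a simplex with barycenter `0`. -/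
noncomputable def simplexVertex (d : ℕ) : Fin (d + 1) → EuclideanSpace ℝ (Fin d) :=
  Fin.cons (-∑ k, EuclideanSpace.single k (1 : ℝ)) fun k => EuclideanSpace.single k 1

theorem sum_smul_simplexVertex {d : ℕ} (c : Fin (d + 1) → ℝ) (k : Fin d) :
    (∑ i, c i • simplexVertex d i) k = c k.succ - c 0 := by
  rw [Fin.sum_univ_succ]
  simp [simplexVertex, Pi.single_apply]
  ring

/-- The vertices of the simplex have only one relation up to scaling. -/
theorem sum_smul_simplexVertex_eq_zero {d : ℕ} {c : Fin (d + 1) → ℝ} :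
    ∑ i, c i • simplexVertex d i = 0 ↔ ∀ i, c i = c 0 := by
  constructor
  · intro h i
    refine Fin.cases rfl (fun k => ?_) i
    have := sum_smul_simplexVertex c k
    rw [h] at this
    simp at this
    linarith
  · intro h
    ext k
    rw [sum_smul_simplexVertex, h k.succ]
    simp

theorem simplexVertex_ne_zero {d : ℕ} (hd : 1 ≤ d) (i : Fin (d + 1)) : simplexVertex d i ≠ 0 := by
  intro h
  have h1 := (sum_smul_simplexVertex_eq_zero (c := Pi.single i 1)).1 (by
    rw [sum_eq_single i] <;> simp +contextual [h])
  have : Nontrivial (Fin (d + 1)) := Fin.nontrivial_iff_two_le.2 (by omega)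
  obtain ⟨k, hk⟩ := exists_ne i
  have h2 := (h1 i).trans (h1 k).symm
  simp [hk] at h2

/-- Every subspace that contains the vertices of the simplex is the whole space. -/
theorem eq_top_of_simplexVertex_mem {d : ℕ} {p : Submodule ℝ (EuclideanSpace ℝ (Fin d))}
    (h : ∀ i, simplexVertex d i ∈ p) : p = ⊤ := by
  rw [eq_top_iff, ← (EuclideanSpace.basisFun (Fin d) ℝ).toBasis.span_eq, Submodule.span_le]
  rintro _ ⟨k, rfl⟩
  simpa [simplexVertex] using h k.succ

variable {d : ℕ} {ι : Fin (d + 1) → Type u}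

/-- Nonzero multiples of the vertices of a simplex form a generic family. -/
theorem generic_smul_simplexVertex {a : (i : Fin (d + 1)) → ι i → ℝ} (ha : ∀ i j, a i j ≠ 0) :
    Generic fun i j => a i j • simplexVertex d i := by
  intro s hs c h0
  have e : ∀ i, c i • pick (fun i j => a i j • simplexVertex d i) s i =
      (c i * (s i).elim 0 (a i)) • simplexVertex d i := by
    intro i
    unfold pick
    cases s i <;> simp [mul_smul]
  rw [sum_congr rfl fun i _ => e i, sum_smul_simplexVertex_eq_zero] at h0
  rw [finrank_euclideanSpace_fin] at hs
  obtain ⟨k, hk⟩ : ∃ k, k ∉ colors s := by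
    by_contra! h
    rw [(eq_univ_iff_forall).2 h, card_univ, Fintype.card_fin] at hs
    omega
  have hk' : s k = none := by simpa [mem_colors] using hk
  intro i hi
  obtain ⟨j, hj⟩ := Option.ne_none_iff_exists'.1 (mem_colors.1 hi)
  have h1 := (h0 i).trans (h0 k).symm
  simpa [hj, hk', ha i j] using h1

end Simplex

section Perturbation

variable {d : ℕ}

/-- The matrix whose columns are the given vectors. -/
def columns (x : Fin d → EuclideanSpace ℝ (Fin d)) : Matrix (Fin d) (Fin d) ℝ :=
  Matrix.of fun r i => x i r

theorem linearIndependent_iff_det_columns {x : Fin d → EuclideanSpace ℝ (Fin d)} :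
    LinearIndependent ℝ x ↔ (columns x).det ≠ 0 := by
  rw [← isUnit_iff_ne_zero, ← Matrix.isUnit_iff_isUnit_det,
    ← Matrix.linearIndependent_cols_iff_isUnit]
  have : (columns x).col = (WithLp.linearEquiv 2 ℝ (Fin d → ℝ)).toLinearMap ∘ x := by
    ext i r
    rfl
  rw [this, LinearMap.linearIndependent_iff _ (LinearEquiv.ker _)]

/-- Small perturbations of any vectors in the direction of independent ones are independent,
since their determinant is a nonzero polynomial. -/
theorem eventually_linearIndependent (x : Fin d → EuclideanSpace ℝ (Fin d))
    {y : Fin d → EuclideanSpace ℝ (Fin d)} (hy : LinearIndependent ℝ y) :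
    ∀ᶠ r in 𝓝[≠] (0 : ℝ), LinearIndependent ℝ fun i => x i + r • y i := by
  open Polynomial in
  let P : ℝ[X] := ((X : ℝ[X]) • (columns y).map C + (columns x).map C).det
  have hP : P ≠ 0 := by
    intro h
    have := Polynomial.coeff_det_X_add_C_card (columns y) (columns x)
    rw [show ((Polynomial.X : Polynomial ℝ) • (columns y).map Polynomial.C +
      (columns x).map Polynomial.C).det = P from rfl, h, Polynomial.coeff_zero] at this
    exact linearIndependent_iff_det_columns.1 hy this.symm
  have hroots : {r : ℝ | P.IsRoot r}.Finite := Polynomial.finite_setOfPred_isRoot hP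
  have hmem : ∀ᶠ r in 𝓝[≠] (0 : ℝ), r ∉ {r : ℝ | P.IsRoot r} := by
    have h1 : ({r : ℝ | P.IsRoot r} \ {0})ᶜ ∈ 𝓝 (0 : ℝ) :=
      (hroots.subset Set.sdiff_subset).isClosed.isOpen_compl.mem_nhds (by simp)
    filter_upwards [mem_nhdsWithin_of_mem_nhds h1, self_mem_nhdsWithin] with r hr hr0 hroot
    exact hr ⟨hroot, hr0⟩
  filter_upwards [hmem] with r hr
  rw [linearIndependent_iff_det_columns]
  intro h0
  apply hr
  change P.eval r = 0
  rw [← h0, ← Polynomial.coe_evalRingHom, RingHom.map_det]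
  congr 1
  ext i k
  simp [columns]
  ring

/-- By Cramer's rule the coefficients of a relation depend continuously on the vectors. -/
theorem eventually_exists_relation {x : Fin (d + 1) → EuclideanSpace ℝ (Fin d)}
    (y : Fin (d + 1) → EuclideanSpace ℝ (Fin d)) {c : Fin (d + 1) → ℝ} (hc : ∀ i, 0 < c i)
    (h0 : ∑ i, c i • x i = 0) (hx : LinearIndependent ℝ fun i : Fin d => x i.succ) :
    ∀ᶠ r in 𝓝 (0 : ℝ), ∃ c' : Fin (d + 1) → ℝ, (∀ i, 0 < c' i) ∧
      ∑ i, c' i • (x i + r • y i) = 0 := by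
  let B : ℝ → Matrix (Fin d) (Fin d) ℝ := fun r => columns fun i => x i.succ + r • y i.succ
  let b : ℝ → Fin d → ℝ := fun r k => -(x 0 + r • y 0) k
  have hB : Continuous B := by
    refine continuous_matrix fun k i => ?_
    simp only [B, columns, Matrix.of_apply, PiLp.add_apply, PiLp.smul_apply]
    fun_prop
  have hb : Continuous b := by
    refine continuous_pi fun k => ?_
    simp only [b, PiLp.add_apply, PiLp.smul_apply]
    fun_prop
  have hdet : (B 0).det ≠ 0 := by
    have := linearIndependent_iff_det_columns.1 hx
    simpa [B] using this
  let f : ℝ → Fin (d + 1) → ℝ := fun r =>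
    Fin.cons ((B 0).det * (B r).det) fun i => (B 0).det * Matrix.cramer (B r) (b r) i
  have hf : ∀ i, Continuous fun r => f r i := by
    refine Fin.cases ?_ fun i => ?_
    · exact continuous_const.mul hB.matrix_det
    · exact continuous_const.mul ((continuous_apply i).comp (hB.matrix_cramer hb))
  have hsol : b 0 = (B 0).mulVec fun i => c i.succ / c 0 := by
    rw [Fin.sum_univ_succ] at h0
    ext k
    have hk := congrArg (fun v : EuclideanSpace ℝ (Fin d) => v k) h0
    simp at hk
    simp only [b, B, columns, Matrix.mulVec, dotProduct, Matrix.of_apply, zero_smul, add_zero]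
    have h1 : ∑ i : Fin d, x i.succ k * (c i.succ / c 0) =
        (∑ i : Fin d, c i.succ * x i.succ k) / c 0 := by
      rw [sum_div]
      exact sum_congr rfl fun i _ => by ring
    rw [h1, eq_div_iff (hc 0).ne']
    linarith
  have hf0 : ∀ i, 0 < f 0 i := by
    have hsq : 0 < (B 0).det * (B 0).det := mul_self_pos.2 hdet
    refine Fin.cases hsq fun i => ?_
    change 0 < (B 0).det * Matrix.cramer (B 0) (b 0) i
    rw [Matrix.cramer_eq_adjugate_mulVec, hsol, Matrix.mulVec_mulVec, Matrix.adjugate_mul,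
      Matrix.smul_mulVec, Matrix.one_mulVec, Pi.smul_apply, smul_eq_mul, ← mul_assoc]
    exact mul_pos hsq (div_pos (hc _) (hc 0))
  have hev : ∀ᶠ r in 𝓝 (0 : ℝ), ∀ i, 0 < f r i :=
    eventually_all.2 fun i => (hf i).continuousAt.eventually (lt_mem_nhds (hf0 i))
  filter_upwards [hev] with r hr
  refine ⟨f r, hr, ?_⟩
  rw [Fin.sum_univ_succ]
  ext k
  have h1 := congrFun (Matrix.mulVec_cramer (B r) (b r)) k
  simp only [Matrix.mulVec, dotProduct, Pi.smul_apply, smul_eq_mul] at h1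
  have hbk : b r k = -(x 0 k + r * y 0 k) := rfl
  simp only [f, Fin.cons_zero, Fin.cons_succ, PiLp.add_apply, PiLp.smul_apply, smul_eq_mul,
    WithLp.ofLp_sum, Finset.sum_apply, PiLp.zero_apply, mul_assoc, ← mul_sum]
  have h2 : ∑ i : Fin d, Matrix.cramer (B r) (b r) i * (x i.succ k + r * y i.succ k) =
      ∑ i, B r k i * Matrix.cramer (B r) (b r) i := by
    refine sum_congr rfl fun i _ => ?_
    simp [B, columns]
    ring
  rw [h2, h1, hbk]
  ring

end Perturbation

end ColorfulDepth

/-! ### The upper bound -/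

namespace ColorfulDepth

open Finset Module Filter Topology

section UpperBound

variable {d : ℕ} {ι : Fin (d + 1) → Type u}

/-- A family is generic if the `d` vectors of any transversal without one color are independent. -/
theorem generic_of_linearIndependent [∀ i, Nonempty (ι i)]
    {x : (i : Fin (d + 1)) → ι i → EuclideanSpace ℝ (Fin d)}
    (h : ∀ (t : (i : Fin (d + 1)) → ι i) (k : Fin (d + 1)),
      LinearIndependent ℝ fun i : Fin d => x (k.succAbove i) (t (k.succAbove i))) :
    Generic x := by
  classical
  intro s hs c h0
  rw [finrank_euclideanSpace_fin] at hs
  obtain ⟨k, hk⟩ : ∃ k, k ∉ colors s := by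
    by_contra! h
    rw [(eq_univ_iff_forall).2 h, card_univ, Fintype.card_fin] at hs
    omega
  let t : (i : Fin (d + 1)) → ι i := fun i => (s i).getD (Classical.arbitrary _)
  have e : ∀ i, c i • pick x s i = (if i ∈ colors s then c i else 0) • x i (t i) := by
    intro i
    by_cases hi : i ∈ colors s
    · obtain ⟨j, hj⟩ := Option.ne_none_iff_exists'.1 (mem_colors.1 hi)
      simp [hi, pick, t, hj]
    · simp [hi, pick_of_notMem x hi]
  rw [sum_congr rfl fun i _ => e i, Fin.sum_univ_succAbove _ k, if_neg hk, zero_smul, zero_add]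
    at h0
  intro i hi
  obtain ⟨i, rfl⟩ := Fin.exists_succAbove_eq (x := i) (y := k) (by rintro rfl; exact hk hi)
  have := Fintype.linearIndependent_iff.1 (h t k) _ h0 i
  simpa [hi] using this

theorem Generic.linearIndependent {x : (i : Fin (d + 1)) → ι i → EuclideanSpace ℝ (Fin d)}
    (hx : Generic x) (t : (i : Fin (d + 1)) → ι i) (k : Fin (d + 1)) :
    LinearIndependent ℝ fun i : Fin d => x (k.succAbove i) (t (k.succAbove i)) := by
  rw [Fintype.linearIndependent_iff]
  intro g hg i
  have hcol : colors (fun i => some (t i)) = univ := by simp [colors]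
  have := hx.eq_zero (s := fun i => some (t i)) (T := univ.erase k) (c := k.insertNth 0 g)
    (by rw [hcol]; exact erase_subset _ _) (by simp) (fun i hi _ => by
      have : i = k := by simpa using hi
      subst this
      simp) (by
      rw [Fin.sum_univ_succAbove _ k]
      simpa [pick] using hg) (k.succAbove i) (by rw [hcol]; exact mem_univ _)
  simpa using this

theorem exists_ne_zero_sum_mul_eq_zero {A : Type*} [Fintype A] [Nontrivial A] {w : A → ℝ}
    (hw : ∀ j, 0 < w j) : ∃ a : A → ℝ, (∀ j, a j ≠ 0) ∧ ∑ j, w j * a j = 0 := by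
  classical
  obtain ⟨j₀, j₁, hj⟩ := exists_pair_ne A
  have hpos : 0 < ∑ j ∈ univ.erase j₀, w j :=
    sum_pos (fun j _ => hw j) ⟨j₁, by simp [hj.symm]⟩
  refine ⟨fun j => if j = j₀ then -(∑ j ∈ univ.erase j₀, w j) / w j₀ else 1, fun j => ?_, ?_⟩
  · by_cases h : j = j₀
    · simp only [if_pos h]
      exact div_ne_zero (neg_ne_zero.2 hpos.ne') (hw j₀).ne'
    · simp only [if_neg h]
      exact one_ne_zero
  · dsimp only
    have e : ∀ j ∈ univ.erase j₀,
        w j * (if j = j₀ then -(∑ j ∈ univ.erase j₀, w j) / w j₀ else 1) = w j := fun j hj => by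
      rw [if_neg (ne_of_mem_erase hj), mul_one]
    rw [← add_sum_erase univ _ (mem_univ j₀), sum_congr rfl e, if_pos rfl,
      mul_div_cancel₀ _ (hw j₀).ne', neg_add_cancel]

variable [∀ i, Fintype (ι i)]

/-- The bound for `C` follows if there is a generic balanced family `x` for which the origin is
still in every hitting simplex of `C`. -/
theorem csd_le_of_generic {C x : (i : Fin (d + 1)) → ι i → EuclideanSpace ℝ (Fin d)}
    (hx : Generic x) (hb : Balanced x) (h : ∀ t, IsHitting C (vertices t univ) →
      ∃ c : Fin (d + 1) → ℝ, (∀ i, 0 < c i) ∧ ∑ i, c i • x i (t i) = 0) :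
    csd C ≤ 1 + ∏ i, (Fintype.card (ι i) - 1) := by
  classical
  refine le_trans ?_ (card_not_avoids_le (by simp) hx hb)
  rw [csd, ← card_image_of_injective _ vertices_univ_injective, ← Set.ncard_coe_finset]
  refine Set.ncard_le_ncard ?_ (Finset.finite_toSet _)
  intro S hS
  obtain ⟨t, rfl⟩ := hS.1.exists_eq_vertices hS.2.2.1
  obtain ⟨c, hc, h0⟩ := h t hS
  simp only [coe_image, Set.mem_image, mem_coe, mem_filter, mem_univ, true_and]
  refine ⟨t, fun ha => ?_, rfl⟩
  have := ha c (fun i => (hc i).le) (by simpa [pick] using h0) 0 (by simp [colors])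
  exact (hc 0).ne' this

/-- A color class of a centered configuration with a hitting simplex has at least two points. -/
theorem nontrivial_of_isHitting (hd : d ≠ 0)
    {C : (i : Fin (d + 1)) → ι i → EuclideanSpace ℝ (Fin d)} (hb : Balanced C)
    (hC : InRelativeGeneralPosition C) {S : Finset ((i : Fin (d + 1)) × ι i)}
    (hS : IsHitting C S) (i : Fin (d + 1)) : Nontrivial (ι i) := by
  by_contra hn
  rw [not_nontrivial_iff_subsingleton] at hn
  obtain ⟨t, -, ⟨c, hc, h0⟩, hli⟩ := hS.exists_relation hC
  -- A single point would have to be the origin.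
  have hzero : C i (t i) = 0 := by
    obtain ⟨-, w, hw, hw0⟩ := hb i
    rw [Fintype.sum_subsingleton _ (t i)] at hw0
    exact (smul_eq_zero.1 hw0).resolve_left (hw _).ne'
  revert hzero
  refine Fin.cases (fun hzero => ?_) (fun i hzero => hli.ne_zero i hzero) i
  rw [Fin.sum_univ_succ, hzero, smul_zero, zero_add] at h0
  exact (hc _).ne' (Fintype.linearIndependent_iff.1 hli _ h0 ⟨0, Nat.pos_of_ne_zero hd⟩)

theorem csd_le {C : (i : Fin (d + 1)) → ι i → EuclideanSpace ℝ (Fin d)} (hcent : IsCentered C)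
    (hC : InRelativeGeneralPosition C) : csd C ≤ 1 + ∏ i, (Fintype.card (ι i) - 1) := by
  have hb := hcent.balanced
  have : ∀ i, Nonempty (ι i) := fun i => (hb i).1
  have hrel : ∀ t, IsHitting C (vertices t univ) →
      (∃ c : Fin (d + 1) → ℝ, (∀ i, 0 < c i) ∧ ∑ i, c i • C i (t i) = 0) ∧
        LinearIndependent ℝ fun i : Fin d => C i.succ (t i.succ) := by
    intro t ht
    obtain ⟨t', htt', h⟩ := ht.exists_relation hC
    rwa [← vertices_univ_injective htt'] at h
  rcases eq_or_ne d 0 with rfl | hd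
  · refine csd_le_of_generic (x := C) (fun s hs c _ i hi => ?_) hb fun t ht => (hrel t ht).1
    rw [finrank_euclideanSpace_fin, Nat.le_zero, card_eq_zero] at hs
    simp [hs] at hi
  by_cases hex : ∃ S, IsHitting C S
  · obtain ⟨S, hS⟩ := hex
    have hnt := nontrivial_of_isHitting hd hb hC hS
    choose hne w hw hw0 using hb
    choose a ha ha0 using fun i => exists_ne_zero_sum_mul_eq_zero (hw i)
    -- Perturb in a generic direction that preserves the relation of each color class.
    have h1 : ∀ᶠ r in 𝓝[≠] (0 : ℝ), ∀ (t : (i : Fin (d + 1)) → ι i) (k : Fin (d + 1)),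
        LinearIndependent ℝ fun i : Fin d => C (k.succAbove i) (t (k.succAbove i)) +
          r • a (k.succAbove i) (t (k.succAbove i)) • simplexVertex d (k.succAbove i) :=
      eventually_all.2 fun t => eventually_all.2 fun k => eventually_linearIndependent _
        ((generic_smul_simplexVertex ha).linearIndependent t k)
    have h2 : ∀ᶠ r in 𝓝 (0 : ℝ), ∀ t, IsHitting C (vertices t univ) →
        ∃ c : Fin (d + 1) → ℝ, (∀ i, 0 < c i) ∧
          ∑ i, c i • (C i (t i) + r • a i (t i) • simplexVertex d i) = 0 := by
      refine eventually_all.2 fun t => ?_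
      by_cases ht : IsHitting C (vertices t univ)
      · obtain ⟨⟨c, hc, h0⟩, hli⟩ := hrel t ht
        filter_upwards [eventually_exists_relation
          (fun i => a i (t i) • simplexVertex d i) hc h0 hli] with r hr _ using hr
      · exact Eventually.of_forall fun r h => absurd h ht
    obtain ⟨r, hr1, hr2⟩ := (h1.and (h2.filter_mono nhdsWithin_le_nhds)).exists
    refine csd_le_of_generic (x := fun i j => C i j + r • a i j • simplexVertex d i)
      (generic_of_linearIndependent hr1) (fun i => ⟨hne i, w i, hw i, ?_⟩) hr2
    have e : ∀ j, w i j • (C i j + r • a i j • simplexVertex d i) =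
        w i j • C i j + (r * (w i j * a i j)) • simplexVertex d i := by
      intro j
      module
    rw [sum_congr rfl fun j _ => e j, sum_add_distrib, hw0, ← sum_smul, ← mul_sum, ha0]
    simp
  · have : {S | IsHitting C S} = ∅ := by
      ext S
      simpa using fun h => hex ⟨S, h⟩
    rw [csd, this, Set.ncard_empty]
    exact Nat.zero_le _

end UpperBound

end ColorfulDepth

/-! ### Configurations attaining the bound -/

namespace ColorfulDepth

open Finset Module

section Example

/-- The origin is in the relative interior of the convex hull of points on both sides of it on a
line. -/
theorem zero_mem_intrinsicInterior_smul {E : Type*} [NormedAddCommGroup E] [NormedSpace ℝ E]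
    {A : Type*} {a : A → ℝ} {v : E} (hv : v ≠ 0) {j₀ j₁ : A} (h₀ : a j₀ < 0) (h₁ : 0 < a j₁) :
    (0 : E) ∈ intrinsicInterior ℝ (convexHull ℝ (Set.range fun j => a j • v)) := by
  set K := convexHull ℝ (Set.range fun j => a j • v) with hK
  have hseg : ∀ r, a j₀ ≤ r → r ≤ a j₁ → r • v ∈ K := by
    intro r hr₀ hr₁
    have hlt : 0 < a j₁ - a j₀ := by linarith
    have h := (convex_convexHull ℝ (Set.range fun j => a j • v))
      (subset_convexHull ℝ _ ⟨j₀, rfl⟩) (subset_convexHull ℝ _ ⟨j₁, rfl⟩)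
      (a := (a j₁ - r) / (a j₁ - a j₀)) (b := (r - a j₀) / (a j₁ - a j₀))
      (div_nonneg (by linarith) hlt.le) (div_nonneg (by linarith) hlt.le) (by field_simp; ring)
    have e : r = (a j₁ - r) / (a j₁ - a j₀) * a j₀ + (r - a j₀) / (a j₁ - a j₀) * a j₁ := by
      field_simp
      ring
    rw [e, add_smul, mul_smul, mul_smul]
    exact h
  have h0K : (0 : E) ∈ K := by simpa using hseg 0 h₀.le h₁.le
  have hline : ∀ y ∈ affineSpan ℝ K, ∃ r : ℝ, r • v = y := by
    have hle : affineSpan ℝ K ≤ (Submodule.span ℝ {v}).toAffineSubspace := by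
      refine affineSpan_le.2 (convexHull_min ?_ (Submodule.convex _))
      rintro _ ⟨j, rfl⟩
      exact Submodule.smul_mem _ _ (Submodule.mem_span_singleton_self v)
    exact fun y hy => Submodule.mem_span_singleton.1 (hle hy)
  have hδ : 0 < min (-a j₀) (a j₁) := lt_min (by linarith) h₁
  refine mem_intrinsicInterior.2 ⟨⟨0, subset_affineSpan ℝ K h0K⟩, ?_, rfl⟩
  rw [mem_interior_iff_mem_nhds]
  refine Metric.mem_nhds_iff.2 ⟨min (-a j₀) (a j₁) * ‖v‖, mul_pos hδ (norm_pos_iff.2 hv), ?_⟩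
  rintro ⟨y, hy⟩ hball
  obtain ⟨r, rfl⟩ := hline y hy
  rw [Metric.mem_ball, Subtype.dist_eq, dist_zero_right, norm_smul, Real.norm_eq_abs] at hball
  have hr := lt_of_mul_lt_mul_right hball (norm_nonneg v)
  have hr₀ := (abs_lt.1 (hr.trans_le (min_le_left _ _))).1
  have hr₁ := (abs_lt.1 (hr.trans_le (min_le_right _ _))).2
  exact hseg r (by linarith) hr₁.le

variable {d : ℕ} {ι : Fin (d + 1) → Type u}

/-- For multiples of the vertices of a simplex, a colorful simplex around the origin uses all
colors, so its affine span is the whole space. -/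
theorem inRelativeGeneralPosition_smul_simplexVertex {a : (i : Fin (d + 1)) → ι i → ℝ}
    (ha : ∀ i j, a i j ≠ 0) : InRelativeGeneralPosition fun i j => a i j • simplexVertex d i := by
  classical
  intro S hS hdim h0
  have hpts : points (fun i j => a i j • simplexVertex d i) S =
      Set.range fun p : S => a p.1.1 p.1.2 • simplexVertex d p.1.1 := by
    ext y
    simp [points]
  have hsub := subset_vectorSpan h0
  rw [hpts] at h0
  obtain ⟨w, -, hw1, hw0⟩ := zero_mem_convexHull_range h0
  -- The coefficient of the vertex of color `i` in the relation.
  let b : Fin (d + 1) → ℝ := fun i =>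
    ∑ p : S, if p.1.1 = i then w p * a p.1.1 p.1.2 else 0
  have hb : ∑ i, b i • simplexVertex d i = 0 := by
    rw [← hw0]
    simp only [b, sum_smul]
    rw [sum_comm]
    refine sum_congr rfl fun p _ => ?_
    simp [mul_smul]
  rw [sum_smul_simplexVertex_eq_zero] at hb
  have hbS : ∀ p : S, b p.1.1 = w p * a p.1.1 p.1.2 := by
    intro p
    simp only [b]
    rw [sum_eq_single p]
    · simp
    · intro q _ hq
      rw [if_neg]
      exact fun h => hq (Subtype.ext (hS _ q.2 _ p.2 h))
    · simp
  have hall : ∀ i, ∃ j : ι i, (⟨i, j⟩ : (i : Fin (d + 1)) × ι i) ∈ S := by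
    by_contra! h
    obtain ⟨i, hi⟩ := h
    have hbi : b i = 0 := by
      refine sum_eq_zero fun p _ => ?_
      rw [if_neg]
      rintro rfl
      exact hi p.1.2 p.2
    have hw : ∀ p : S, w p = 0 := by
      intro p
      have h1 := hbS p
      rw [hb, ← hb i, hbi] at h1
      exact (mul_eq_zero.1 h1.symm).resolve_right (ha _ _)
    simp [hw] at hw1
  have htop := eq_top_of_simplexVertex_mem (p := vectorSpan ℝ
    (points (fun i j => a i j • simplexVertex d i) S)) fun i => by
      obtain ⟨j, hj⟩ := hall i
      have h1 := hsub (show a i j • simplexVertex d i ∈ _ from ⟨⟨i, j⟩, hj, rfl⟩)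
      exact (Submodule.smul_mem_iff _ (ha i j)).1 h1
  rw [dim, htop, finrank_top, finrank_euclideanSpace_fin] at hdim
  omega

theorem isHitting_smul_simplexVertex {a : (i : Fin (d + 1)) → ι i → ℝ} (ha : ∀ i j, a i j ≠ 0)
    {t : (i : Fin (d + 1)) → ι i} {r : ℝ} (hr : ∀ i, 0 < r * a i (t i)) :
    IsHitting (fun i j => a i j • simplexVertex d i) (vertices t univ) := by
  have hp : points (fun i j => a i j • simplexVertex d i) (vertices t univ) =
      Set.range fun i => a i (t i) • simplexVertex d i := by
    rw [points_vertices, coe_univ, Set.image_univ]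
  have hinv : 0 < ∑ i, (r * a i (t i))⁻¹ := sum_pos (fun i _ => inv_pos.2 (hr i)) univ_nonempty
  have h0 : (0 : EuclideanSpace ℝ (Fin d)) ∈
      convexHull ℝ (points (fun i j => a i j • simplexVertex d i) (vertices t univ)) := by
    have hsum : ∑ i, (r * a i (t i))⁻¹ • a i (t i) • simplexVertex d i = 0 := by
      have e : ∀ i, (r * a i (t i))⁻¹ • a i (t i) • simplexVertex d i =
          r⁻¹ • simplexVertex d i := by
        intro i
        rw [smul_smul, mul_inv, mul_assoc, inv_mul_cancel₀ (ha i (t i)), mul_one]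
      rw [sum_congr rfl fun i _ => e i]
      exact sum_smul_simplexVertex_eq_zero.2 fun _ => rfl
    rw [hp]
    have := (convex_convexHull ℝ (Set.range fun i => a i (t i) • simplexVertex d i)).sum_mem
      (t := univ) (w := fun i => (∑ i, (r * a i (t i))⁻¹)⁻¹ * (r * a i (t i))⁻¹)
      (z := fun i => a i (t i) • simplexVertex d i)
      (fun i _ => mul_nonneg (inv_pos.2 hinv).le (inv_pos.2 (hr i)).le)
      (by rw [← mul_sum, inv_mul_cancel₀ hinv.ne']) fun i _ => subset_convexHull ℝ _ ⟨i, rfl⟩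
    simpa only [mul_smul, ← smul_sum, hsum, smul_zero] using this
  refine ⟨isColorful_vertices _ _, ?_, by simp [vertices], h0⟩
  have hsub := subset_vectorSpan h0
  rw [dim, eq_top_of_simplexVertex_mem (p := vectorSpan ℝ
    (points (fun i j => a i j • simplexVertex d i) (vertices t univ))), finrank_top,
    finrank_euclideanSpace_fin]
  intro i
  have h1 := hsub (show a i (t i) • simplexVertex d i ∈ _ by rw [hp]; exact ⟨i, rfl⟩)
  exact (Submodule.smul_mem_iff _ (ha i (t i))).1 h1

/-- Multiples of the vertices of a simplex with factors of different absolute values are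
different. -/
theorem injective_smul_simplexVertex {a : ((i : Fin (d + 1)) × ι i) → ℝ}
    (hinj : Function.Injective fun p => |a p|) (hd : 1 ≤ d) :
    Function.Injective fun p => a p • simplexVertex d p.1 := by
  intro p q h
  apply hinj
  by_cases hpq : p.1 = q.1
  · simp only [hpq] at h
    exact congrArg abs (smul_left_injective ℝ (simplexVertex_ne_zero hd q.1) h)
  · have h1 := (sum_smul_simplexVertex_eq_zero
      (c := fun i => (if i = p.1 then a p else 0) - if i = q.1 then a q else 0)).1 (by
        simp only [sub_smul, sum_sub_distrib, ite_smul, zero_smul, sum_ite_eq', mem_univ, if_true]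
        exact sub_eq_zero.2 h)
    have h2 := (h1 p.1).trans (h1 q.1).symm
    simp [hpq, Ne.symm hpq] at h2
    simp [h2]

/-- The configuration attaining the bound: in each color class one point is a negative and the
others are positive multiples of the same vertex of a simplex. -/
theorem exists_csd_eq (hd : 1 ≤ d) (n : Fin (d + 1) → ℕ) (hn : ∀ i, 2 ≤ n i) :
    ∃ C : (i : Fin (d + 1)) → Fin (n i) → EuclideanSpace ℝ (Fin d),
      Function.Injective (fun p : (i : Fin (d + 1)) × Fin (n i) => C p.1 p.2) ∧
      IsCentered C ∧ InRelativeGeneralPosition C ∧ csd C = 1 + ∏ i, (n i - 1) := by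
  classical
  let e := Fintype.equivFin ((i : Fin (d + 1)) × Fin (n i))
  let j₀ : (i : Fin (d + 1)) → Fin (n i) := fun i => ⟨0, by have := hn i; omega⟩
  let j₁ : (i : Fin (d + 1)) → Fin (n i) := fun i => ⟨1, by have := hn i; omega⟩
  let a : ((i : Fin (d + 1)) × Fin (n i)) → ℝ := fun p =>
    if p.2 = j₀ p.1 then -((e p : ℕ) + 1 : ℝ) else (e p : ℕ) + 1
  have hneg : ∀ i, a ⟨i, j₀ i⟩ < 0 := fun i => by
    simp only [a, if_true]
    linarith [(Nat.cast_nonneg (e ⟨i, j₀ i⟩ : ℕ) : (0 : ℝ) ≤ _)]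
  have hpos : ∀ i j, j ≠ j₀ i → 0 < a ⟨i, j⟩ := fun i j hj => by
    simp only [a, hj, if_false]
    positivity
  have ha : ∀ p, a p ≠ 0 := by
    rintro ⟨i, j⟩
    by_cases hj : j = j₀ i
    · rw [hj]; exact (hneg i).ne
    · exact (hpos i j hj).ne'
  have habs : ∀ p, |a p| = (e p : ℕ) + 1 := by
    intro p
    have : (0 : ℝ) < (e p : ℕ) + 1 := by positivity
    simp only [a]
    split_ifs
    · rw [abs_neg, abs_of_pos this]
    · rw [abs_of_pos this]
  have hinj : Function.Injective fun p => |a p| := by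
    intro p q h
    simp only [habs, add_left_inj, Nat.cast_inj] at h
    exact e.injective (Fin.ext h)
  have hj : ∀ i, j₁ i ≠ j₀ i := fun i h => by
    have := congrArg Fin.val h
    simp [j₀, j₁] at this
  have hcent : IsCentered fun i j => a ⟨i, j⟩ • simplexVertex d i := fun i =>
    zero_mem_intrinsicInterior_smul (simplexVertex_ne_zero hd i) (hneg i) (hpos i _ (hj i))
  have hgen : InRelativeGeneralPosition fun i j => a ⟨i, j⟩ • simplexVertex d i :=
    inRelativeGeneralPosition_smul_simplexVertex (a := fun i j => a ⟨i, j⟩) fun i j => ha _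
  refine ⟨fun i j => a ⟨i, j⟩ • simplexVertex d i, injective_smul_simplexVertex hinj hd,
    hcent, hgen, le_antisymm (by simpa using csd_le hcent hgen) ?_⟩
  -- The transversals of negative multiples and of positive multiples are hitting.
  let F : Finset ((i : Fin (d + 1)) → Fin (n i)) :=
    insert j₀ (Fintype.piFinset fun i => univ.erase (j₀ i))
  have hF : #F = 1 + ∏ i, (n i - 1) := by
    rw [card_insert_of_notMem, Fintype.card_piFinset, add_comm]
    · simp
    · intro h
      exact absurd (Fintype.mem_piFinset.1 h 0) (by simp)
  rw [← hF, csd, ← card_image_of_injective _ vertices_univ_injective, ← Set.ncard_coe_finset]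
  refine Set.ncard_le_ncard ?_ (Set.toFinite _)
  intro S hS
  obtain ⟨t, ht, rfl⟩ := mem_image.1 (mem_coe.1 hS)
  rcases mem_insert.1 ht with rfl | ht
  · exact isHitting_smul_simplexVertex (a := fun i j => a ⟨i, j⟩) (r := -1) (fun i j => ha _)
      fun i => by linarith [hneg i]
  · refine isHitting_smul_simplexVertex (a := fun i j => a ⟨i, j⟩) (r := 1) (fun i j => ha _)
      fun i => ?_
    rw [one_mul]
    exact hpos i _ (ne_of_mem_erase (Fintype.mem_piFinset.1 ht i))

end Example

end ColorfulDepth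

theorem theorem2 (d : ℕ) :
    (∀ (ι : Fin (d + 1) → Type u) [∀ i, Fintype (ι i)]
        (C : (i : Fin (d + 1)) → ι i → EuclideanSpace ℝ (Fin d)),
      ColorfulDepth.IsCentered C → ColorfulDepth.InRelativeGeneralPosition C →
        ColorfulDepth.csd C ≤ 1 + ∏ i, (Fintype.card (ι i) - 1)) ∧
    (1 ≤ d → ∀ n : Fin (d + 1) → ℕ, (∀ i, 2 ≤ n i) →
      ∃ C : (i : Fin (d + 1)) → Fin (n i) → EuclideanSpace ℝ (Fin d),
        Function.Injective (fun p : (i : Fin (d + 1)) × Fin (n i) => C p.1 p.2) ∧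
        ColorfulDepth.IsCentered C ∧ ColorfulDepth.InRelativeGeneralPosition C ∧
        ColorfulDepth.csd C = 1 + ∏ i, (n i - 1)) ∧
    (∀ (ι : Fin (d + 1) → Type u) [∀ i, Fintype (ι i)]
        (C : (i : Fin (d + 1)) → ι i → EuclideanSpace ℝ (Fin d)),
      ColorfulDepth.IsCentered C → ColorfulDepth.InRelativeGeneralPosition C →
        (∀ i, Fintype.card (ι i) = d + 1) → ColorfulDepth.csd C ≤ 1 + d ^ (d + 1)) := by
  refine ⟨fun ι _ C => ColorfulDepth.csd_le, ColorfulDepth.exists_csd_eq,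
    fun ι _ C hcent hC hcard => ?_⟩
  simpa [hcard] using ColorfulDepth.csd_le hcent hC
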